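/- Let $m\ge 4$, and read indices modulo $m$. Use the coordinates $s_{11},\dots,s_{mm}$ and $s_{i,i+1}$ $(1\le i\le m)$, where $s_{m,m+1}=s_{m1}=s_{1m}$, on $\mathbb{R}^{2m}\subset\mathbb{C}^{2m}$. Let $\mathcal{C}_m\subset\mathbb{R}^{2m}$ be the cone of sufficient statistics of the $m$-cycle, i.e. the image of the set of positive definite real symmetric $m\times m$ matrices $S$ under $S\mapsto\bigl((S_{ii})_i,(S_{i,i+1})_i\bigr)$, and let $\partial\mathcal{C}_m=\overline{\mathcal{C}_m}\setminus\mathcal{C}_m$, with the closure taken in the Euclidean topology. There is an irreducible polynomial $\Gamma'_m\in\mathbb{C}[x_1,\dots,x_m]$, unique up to multiplication by a nonzero constant, obtained by rationalizing $x_1=\cos\bigl(\sum_{i=2}^m\arccos(x_i)\bigr)$, i.e. vanishing at all real points $x$ with $x_2,\dots,x_m\in[-1,1]$ that satisfy this equation. The substitution $x_i=s_{i,i+1}/\sqrt{s_{ii}s_{i+1,i+1}}$ (on the region where all $s_{ii}>0$) turns $\Gamma'_m$ into a rational function of the $s_{ij}$; let $\Gamma_m\in\mathbb{C}[s_{ii},s_{i,i+1}]$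 be its numerator in lowest terms, which is unique up to multiplication by a nonzero constant. Put $$H_{C_m}\;=\;\Gamma_m\cdot\prod_{i=1}^m\bigl(s_{ii}s_{i+1,i+1}-s_{i,i+1}^2\bigr).$$ Then $H_{C_m}$ is the defining polynomial of the Zariski closure of $\partial\mathcal{C}_m$ in $\mathbb{C}^{2m}$: this closure is the hypersurface $\{H_{C_m}=0\}$, and the ideal of all polynomials in $\mathbb{C}[s_{ii},s_{i,i+1}]$ vanishing on $\partial\mathcal{C}_m$ is generated by $H_{C_m}$. -/

import Mathlib

/-!
The `m`-cycle has vertices `Fin m` and edges `{i, i + 1}`, with cyclic addition in `Fin m`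
(so the first vertex is `0`).  Coordinates on `ℝ^{2m}` and `ℂ^{2m}` are indexed by
`Fin m ⊕ Fin m`: `Sum.inl i` is `s_{i,i}` and `Sum.inr i` is `s_{i,i+1}`.
-/

namespace CycleCone

/-- The sufficient statistics of a symmetric matrix with respect to the `m`-cycle:
its diagonal entries and its entries at the edges of the cycle. -/
def suffStat (m : ℕ) [NeZero m] (S : Matrix (Fin m) (Fin m) ℝ) : Fin m ⊕ Fin m → ℝ :=
  Sum.elim (fun i => S i i) (fun i => S i (i + 1))

/-- The cone of sufficient statistics of the `m`-cycle: the image of the cone of positive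
definite matrices. -/
def cone (m : ℕ) [NeZero m] : Set (Fin m ⊕ Fin m → ℝ) :=
  suffStat m '' {S | S.PosDef}

/-- The boundary of the (open) cone: its Euclidean closure minus the cone. -/
def coneBoundary (m : ℕ) [NeZero m] : Set (Fin m ⊕ Fin m → ℝ) :=
  closure (cone m) \ cone m

/-- A real point as a point of complex affine space. -/
def toComplex {σ : Type*} (x : σ → ℝ) : σ → ℂ := fun i => (x i : ℂ)

/-- The ideal of all complex polynomials that vanish on a set of real points. -/
noncomputable def realVanishingIdeal {σ : Type*} (A : Set (σ → ℝ)) : Ideal (MvPolynomial σ ℂ) :=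
  MvPolynomial.vanishingIdeal ℂ (toComplex '' A)

/-- The Zariski closure, in complex affine space, of a set of real points. -/
noncomputable def zariskiClosure {σ : Type*} (A : Set (σ → ℝ)) : Set (σ → ℂ) :=
  MvPolynomial.zeroLocus ℂ (realVanishingIdeal A)

/-- `P` is an `m`-th cycle polynomial: an irreducible polynomial obtained by rationalizing
`x₁ = cos (∑_{i ≥ 2} arccos xᵢ)`, that is, one which vanishes at all solutions of this equation
with `x₂, …, x_m` in the interval `[-1, 1]` (where `arccos` is defined). -/
def IsCyclePolynomial (m : ℕ) [NeZero m] (P : MvPolynomial (Fin m) ℂ) : Prop :=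
  Irreducible P ∧
    ∀ x : Fin m → ℝ, (∀ i, i ≠ 0 → x i ∈ Set.Icc (-1 : ℝ) 1) →
      x 0 = Real.cos (∑ i ∈ Finset.univ.erase 0, Real.arccos (x i)) →
      MvPolynomial.eval (toComplex x) P = 0

/-- The substitution `xᵢ = s_{i,i+1} / √(s_{i,i} s_{i+1,i+1})`. -/
noncomputable def normalize (m : ℕ) [NeZero m] (s : Fin m ⊕ Fin m → ℝ) : Fin m → ℝ :=
  fun i => s (Sum.inr i) / Real.sqrt (s (Sum.inl i) * s (Sum.inl (i + 1)))

/-- `Q` is the numerator (unique up to scaling) of the image of `P` under the substitution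
`xᵢ = s_{i,i+1} / √(s_{i,i} s_{i+1,i+1})`: this image is the rational function `Q / D` in lowest
terms.  The identity is stated on the open set where all `s_{i,i}` are positive. -/
def IsNumerator (m : ℕ) [NeZero m] (P : MvPolynomial (Fin m) ℂ)
    (Q : MvPolynomial (Fin m ⊕ Fin m) ℂ) : Prop :=
  ∃ D : MvPolynomial (Fin m ⊕ Fin m) ℂ, D ≠ 0 ∧ IsRelPrime Q D ∧
    ∀ s : Fin m ⊕ Fin m → ℝ, (∀ i, 0 < s (Sum.inl i)) →
      MvPolynomial.eval (toComplex s) Q =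
        MvPolynomial.eval (toComplex s) D * MvPolynomial.eval (toComplex (normalize m s)) P

/-- The `2 × 2` minor `s_{i,i} s_{i+1,i+1} - s_{i,i+1}²`. -/
noncomputable def edgeMinor (m : ℕ) [NeZero m] (i : Fin m) : MvPolynomial (Fin m ⊕ Fin m) ℂ :=
  MvPolynomial.X (Sum.inl i) * MvPolynomial.X (Sum.inl (i + 1)) - MvPolynomial.X (Sum.inr i) ^ 2

/-- The polynomial `Γ · ∏ᵢ (s_{i,i} s_{i+1,i+1} - s_{i,i+1}²)`. -/
noncomputable def boundaryPolynomial (m : ℕ) [NeZero m] (Γ : MvPolynomial (Fin m ⊕ Fin m) ℂ) :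
    MvPolynomial (Fin m ⊕ Fin m) ℂ :=
  Γ * ∏ i : Fin m, edgeMinor m i

end CycleCone

/-! The boundary ideal is generated by `boundaryPolynomial` for two reasons: this polynomial
vanishes on the boundary, and every `f` vanishing there is divisible by `Γ` and by each edge minor,
which are pairwise coprime irreducibles.

The cycle polynomial is controlled by `cosIdeal`, the ideal of the image of the torus `∏ uᵢ = 1`
under `uᵢ ↦ (uᵢ + uᵢ⁻¹) / 2`. It is prime, it is nonzero because each cosine is integral over the
others, and any irreducible member divides all members (`dvd_of_mem_cosIdeal`). Changing the signs
of two `uᵢ` preserves the torus, so the exponents in each monomial of `P` have equal parity and the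
square roots cancel in the substitution. `Γ` is irreducible because on the cover `s_{i,i} = tᵢ²`,
`s_{i,i+1} = xᵢ tᵢ tᵢ₊₁` it becomes `D · P` with `P` prime, and `Γ` has no factor `s_{i,i}`.

Vanishing: a boundary point is the vector of statistics of a Gram matrix of vectors `vᵢ`. A
supporting functional is stationary there, which gives a three-term relation between `vᵢ₋₁`, `vᵢ`,
`vᵢ₊₁` (`supporting_relation`). If no edge minor vanishes, these relations force all `vᵢ` into one
plane, where the angles around the cycle add up to a multiple of `2π`.

Divisibility: by `dvd_of_common_zeros` it suffices to find, over a box in all coordinates but one,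
boundary points on the given component. For an edge minor, two adjacent vertices are identified and
the other edges are kept small; for `Γ`, the vectors form a planar fan with small angles, where the
triangle inequality for angles makes the last edge extremal. -/

open Polynomial in
/-- Bézout identity over the fraction field with denominators cleared. -/
theorem Polynomial.exists_mul_add_mul_eq_C_of_not_dvd {R : Type*} [CommRing R] [IsDomain R]
    [UniqueFactorizationMonoid R] {Q f : R[X]} (hQ : Irreducible Q) (hdeg : Q.natDegree ≠ 0)
    (hf : ¬ Q ∣ f) : ∃ (a b : R[X]) (r : R), r ≠ 0 ∧ a * Q + b * f = C r := by
  classical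
  let _ : NormalizedGCDMonoid R := Classical.choice inferInstance
  let K := FractionRing R
  have hprim : Q.IsPrimitive := hQ.isPrimitive hdeg
  have hirr : Irreducible (Q.map (algebraMap R K)) :=
    hprim.irreducible_iff_irreducible_map_fraction_map.1 hQ
  have hnd : ¬ Q.map (algebraMap R K) ∣ f.map (algebraMap R K) := fun h =>
    hf (hprim.dvd_of_fraction_map_dvd_fraction_map h)
  obtain ⟨a, b, hab⟩ := (hirr.coprime_iff_not_dvd).2 hnd
  obtain ⟨d, hd, ha⟩ := IsLocalization.integerNormalization_spec (nonZeroDivisors R) a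
  obtain ⟨e, he, hb⟩ := IsLocalization.integerNormalization_spec (nonZeroDivisors R) b
  refine ⟨C e * IsLocalization.integerNormalization (nonZeroDivisors R) a,
    C d * IsLocalization.integerNormalization (nonZeroDivisors R) b, d * e,
    mul_ne_zero (nonZeroDivisors.ne_zero hd) (nonZeroDivisors.ne_zero he), ?_⟩
  apply Polynomial.map_injective (algebraMap R K) (IsFractionRing.injective R K)
  simp only [Polynomial.map_add, Polynomial.map_mul, ha, hb, Polynomial.map_C, map_mul,
    Algebra.smul_def, Polynomial.algebraMap_apply]
  have : (C (algebraMap R K d) * C (algebraMap R K e)) *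
      (a * Q.map (algebraMap R K) + b * f.map (algebraMap R K)) =
      C (algebraMap R K d) * C (algebraMap R K e) := by rw [hab, mul_one]
  rw [← this]
  ring

/-! ### Elimination of one variable and divisibility from common zeros -/

namespace CycleCone

open MvPolynomial

section SplitVariable

variable {ι : Type*} [DecidableEq ι]

/-- Polynomials as univariate polynomials in the variable `k`. -/
noncomputable def splitVar (k : ι) :
    MvPolynomial ι ℂ ≃ₐ[ℂ] Polynomial (MvPolynomial {j // j ≠ k} ℂ) :=
  (renameEquiv ℂ (Equiv.optionSubtypeNe k).symm).trans (optionEquivLeft ℂ _)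

theorem eval_splitVar (k : ι) (z : ι → ℂ) (P : MvPolynomial ι ℂ) :
    Polynomial.eval (z k) (Polynomial.map (eval fun j : {j // j ≠ k} => z j) (splitVar k P)) =
      eval z P := by
  rw [splitVar, AlgEquiv.trans_apply, ← optionEquivLeft_elim_eval, renameEquiv_apply, eval_rename]
  congr 2
  funext j
  by_cases h : j = k
  · subst h; simp
  · simp [Equiv.optionSubtypeNe_symm_of_ne h]

theorem infinite_ofReal_image {s : Set ℝ} (hs : s.Infinite) :
    ((fun x : ℝ => (x : ℂ)) '' s).Infinite :=
  hs.image (Complex.ofReal_injective.injOn)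

theorem eq_zero_of_eval_real {σ : Type*} {P : MvPolynomial σ ℂ} (s : σ → Set ℝ)
    (hs : ∀ i, (s i).Infinite) (h : ∀ x : σ → ℝ, (∀ i, x i ∈ s i) → eval (toComplex x) P = 0) :
    P = 0 := by
  refine funext_set (fun i => (fun x : ℝ => (x : ℂ)) '' s i)
    (fun i => infinite_ofReal_image (hs i)) fun x hx => ?_
  choose y hy hyx using fun i => hx i trivial
  have : x = toComplex y := funext fun i => (hyx i).symm
  rw [this, h y hy, map_zero]

/-- An irreducible polynomial divides every polynomial with which it has a common zero over each
point of a box in the other coordinates. -/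
theorem dvd_of_common_zeros (k : ι) {Q f : MvPolynomial ι ℂ} (hQ : Irreducible Q)
    (s : ι → Set ℝ) (hs : ∀ i, (s i).Infinite)
    (h : ∀ x : ι → ℝ, (∀ i, i ≠ k → x i ∈ s i) → ∃ y : ℝ,
      eval (toComplex (Function.update x k y)) Q = 0 ∧
      eval (toComplex (Function.update x k y)) f = 0) : Q ∣ f := by
  by_contra hnd
  have hQ' : Irreducible (splitVar k Q) := (MulEquiv.irreducible_iff (splitVar k)).2 hQ
  -- The common zeros project onto a Zariski dense box, so no nonzero polynomial in the remaining
  -- variables vanishes at all of them. Both `Q` itself, if it is free of the variable `k`, and the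
  -- Bézout constant of `Q` and `f` would be such a polynomial.
  have key : ∀ r : MvPolynomial {j // j ≠ k} ℂ,
      (∀ z : ι → ℂ, eval z Q = 0 → eval z f = 0 → eval (fun j : {j // j ≠ k} => z j) r = 0) →
      r = 0 := by
    intro r hr
    refine eq_zero_of_eval_real (fun j => s j) (fun j => hs j) fun x hx => ?_
    obtain ⟨y, h1, h2⟩ := h (fun j => if hj : j = k then 0 else x ⟨j, hj⟩)
      (fun i hi => by simpa [hi] using hx ⟨i, hi⟩)
    have := hr _ h1 h2
    have hx' : toComplex x = fun j : {j // j ≠ k} => toComplex (Function.update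
        (fun j => if hj : j = k then 0 else x ⟨j, hj⟩) k y) j :=
      funext fun j => by simp [toComplex, j.2]
    rw [hx', this]
  by_cases hdeg : (splitVar k Q).natDegree = 0
  · obtain ⟨r, hr⟩ := Polynomial.natDegree_eq_zero.1 hdeg
    have : r = 0 := key r fun z hz _ => by
      rw [← eval_splitVar k z, ← hr] at hz
      simpa using hz
    rw [this, map_zero] at hr
    exact hQ'.ne_zero hr.symm
  · obtain ⟨a, b, r, hr0, hr⟩ := Polynomial.exists_mul_add_mul_eq_C_of_not_dvd hQ' hdeg
      (f := splitVar k f) (fun hd => hnd ((map_dvd_iff (splitVar k)).1 hd))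
    refine hr0 (key r fun z h1 h2 => ?_)
    have := congrArg (fun p => Polynomial.eval (z k)
      (Polynomial.map (eval fun j : {j // j ≠ k} => z j) p)) hr
    simp only [Polynomial.map_add, Polynomial.map_mul, Polynomial.eval_add, Polynomial.eval_mul,
      eval_splitVar, h1, h2, mul_zero, add_zero, Polynomial.map_C, Polynomial.eval_C] at this
    exact this.symm

end SplitVariable

/-! ### The ideal of cosines of closed tuples: primality and integrality -/

section Torus

variable {ι : Type*} [Fintype ι] [DecidableEq ι]

/-- The point with coordinates `cos θᵢ`, where `uᵢ = exp (i θᵢ)`. -/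
noncomputable def cosPoint (u : ι → ℂ) : ι → ℂ := fun i => (u i + (u i)⁻¹) / 2

/-- The invertible tuples with product one. -/
def closedTuples (ι : Type*) [Fintype ι] : Set (ι → ℂ) := {u | (∀ i, u i ≠ 0) ∧ ∏ i, u i = 1}

/-- The polynomials satisfied by the cosines of all tuples of angles with sum zero. -/
noncomputable def cosIdeal (ι : Type*) [Fintype ι] : Ideal (MvPolynomial ι ℂ) :=
  vanishingIdeal ℂ (cosPoint '' closedTuples ι)

omit [DecidableEq ι] in
theorem mem_cosIdeal {P : MvPolynomial ι ℂ} :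
    P ∈ cosIdeal ι ↔ ∀ u ∈ closedTuples ι, eval (cosPoint u) P = 0 := by
  simp [cosIdeal, mem_vanishingIdeal_iff, aeval_eq_eval]

/-- Change the coordinate `k` to make the product equal to one. -/
noncomputable def closeUp (k : ι) (u : ι → ℂ) : ι → ℂ :=
  Function.update u k (∏ j ∈ Finset.univ.erase k, u j)⁻¹

theorem closeUp_mem (k : ι) {u : ι → ℂ} (hu : ∀ i, i ≠ k → u i ≠ 0) :
    closeUp k u ∈ closedTuples ι := by
  have hp : ∏ j ∈ Finset.univ.erase k, u j ≠ 0 :=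
    Finset.prod_ne_zero_iff.2 fun j hj => hu j (Finset.ne_of_mem_erase hj)
  constructor
  · intro i
    by_cases h : i = k
    · subst h; simpa [closeUp] using hp
    · simpa [closeUp, h] using hu i h
  · rw [← Finset.mul_prod_erase _ _ (Finset.mem_univ k)]
    have : ∏ x ∈ Finset.univ.erase k, closeUp k u x = ∏ j ∈ Finset.univ.erase k, u j :=
      Finset.prod_congr rfl fun j hj => by simp [closeUp, Finset.ne_of_mem_erase hj]
    rw [this]
    simp [closeUp, hp]

theorem closeUp_eq_self (k : ι) {u : ι → ℂ} (hu : u ∈ closedTuples ι) : closeUp k u = u := by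
  have := hu.2
  rw [← Finset.mul_prod_erase _ _ (Finset.mem_univ k)] at this
  rw [closeUp, ← eq_inv_of_mul_eq_one_left this, Function.update_eq_self]

/-- The coordinates other than `k` parametrize the closed tuples, so `P` pulls back to a Laurent
polynomial; a power of `∏ uᵢ` clears its denominators. This reduces questions about `cosIdeal` to a
polynomial ring, which is a domain. -/
theorem exists_eval_eq_prod_pow_mul (k : ι) (P : MvPolynomial ι ℂ) :
    ∃ (N : ℕ) (F : MvPolynomial ι ℂ), ∀ u : ι → ℂ, (∀ i, u i ≠ 0) →
      eval u F = (∏ i, u i) ^ N * eval (cosPoint (closeUp k u)) P := by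
  induction P using MvPolynomial.induction_on with
  | C a => exact ⟨0, C a, fun u _ => by simp⟩
  | add p q hp hq =>
    obtain ⟨N, F, hF⟩ := hp
    obtain ⟨M, G, hG⟩ := hq
    refine ⟨N + M, F * (∏ i, X i) ^ M + G * (∏ i, X i) ^ N, fun u hu => ?_⟩
    simp only [map_add, map_mul, map_pow, map_prod, eval_X, hF u hu, hG u hu]
    ring
  | mul_X p i hp =>
    obtain ⟨N, F, hF⟩ := hp
    suffices h : ∃ G : MvPolynomial ι ℂ, ∀ u : ι → ℂ, (∀ i, u i ≠ 0) →
        eval u G = (∏ i, u i) * cosPoint (closeUp k u) i by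
      obtain ⟨G, hG⟩ := h
      refine ⟨N + 1, F * G, fun u hu => ?_⟩
      simp only [map_mul, eval_X, hF u hu, hG u hu]
      ring
    by_cases h : i = k
    · subst h
      -- With `p` the product over `j ≠ i`, the closed-up coordinate is `p⁻¹`, and `(∏ u) (p⁻¹ + p)
      -- = uᵢ + (∏ u) p`.
      refine ⟨C (1 / 2) * (X i + (∏ j, X j) * ∏ j ∈ Finset.univ.erase i, X j), fun u hu => ?_⟩
      have hp : ∏ j ∈ Finset.univ.erase i, u j ≠ 0 :=
        Finset.prod_ne_zero_iff.2 fun j _ => hu j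
      simp only [map_mul, map_add, map_prod, eval_X, eval_C, cosPoint, closeUp,
        Function.update_self, inv_inv, ← Finset.mul_prod_erase _ u (Finset.mem_univ i)]
      field_simp
    · refine ⟨C (1 / 2) * ((∏ j, X j) * X i + ∏ j ∈ Finset.univ.erase i, X j), fun u hu => ?_⟩
      have hi := hu i
      simp only [map_mul, map_add, map_prod, eval_X, eval_C, cosPoint, closeUp,
        Function.update_of_ne h, ← Finset.mul_prod_erase _ u (Finset.mem_univ i)]
      field_simp

theorem mem_cosIdeal_of_forall (k : ι) {P : MvPolynomial ι ℂ} (s : ι → Set ℂ)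
    (hs : ∀ i, (s i).Infinite) (h0 : ∀ i, ∀ z ∈ s i, z ≠ 0)
    (h : ∀ u : ι → ℂ, (∀ i, u i ∈ s i) → eval (cosPoint (closeUp k u)) P = 0) :
    P ∈ cosIdeal ι := by
  obtain ⟨N, F, hF⟩ := exists_eval_eq_prod_pow_mul k P
  have hF0 : F = 0 := funext_set s hs fun x hx => by
    rw [hF x fun i => h0 i _ (hx i trivial), h x fun i => hx i trivial]; simp
  refine mem_cosIdeal.2 fun u hu => ?_
  have := hF u hu.1
  rw [hF0, closeUp_eq_self k hu, hu.2] at this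
  simpa using this.symm

instance [Nonempty ι] : (cosIdeal ι).IsPrime := by
  obtain ⟨k⟩ := ‹Nonempty ι›
  have hinf : ({0}ᶜ : Set ℂ).Infinite := (Set.finite_singleton 0).infinite_compl
  refine ⟨fun h => ?_, fun {P Q} hPQ => ?_⟩
  · have h1 : (1 : MvPolynomial ι ℂ) ∈ cosIdeal ι := by rw [h]; trivial
    have := mem_cosIdeal.1 h1 1 ⟨by simp, by simp⟩
    simp at this
  · obtain ⟨N, F, hF⟩ := exists_eval_eq_prod_pow_mul k P
    obtain ⟨M, G, hG⟩ := exists_eval_eq_prod_pow_mul k Q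
    have hFG : F * G = 0 := funext_set (fun _ => {0}ᶜ) (fun _ => hinf) fun x hx => by
      have hx0 : ∀ i, x i ≠ 0 := fun i => hx i trivial
      have := mem_cosIdeal.1 hPQ _ (closeUp_mem k fun i _ => hx0 i)
      rw [map_mul] at this
      rw [map_mul, hF x hx0, hG x hx0, map_zero]
      linear_combination ((∏ i, x i) ^ N * (∏ i, x i) ^ M) * this
    have aux : ∀ (R E : MvPolynomial ι ℂ) (n : ℕ), (∀ u : ι → ℂ, (∀ i, u i ≠ 0) →
        eval u E = (∏ i, u i) ^ n * eval (cosPoint (closeUp k u)) R) → E = 0 →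
        R ∈ cosIdeal ι := by
      intro R E n hE h0
      refine mem_cosIdeal.2 fun u hu => ?_
      have := hE u hu.1
      rw [h0, closeUp_eq_self k hu, hu.2] at this
      simpa using this.symm
    exact (mul_eq_zero.1 hFG).imp (aux P F N hF) (aux Q G M hG)

/-- In the ring of functions on closed tuples, `uⱼ` and `uⱼ⁻¹` are roots of `T² - 2 yⱼ T + 1`, and
for the index `k` they are products of the others. Hence `y k` is integral over the other cosines,
and its integral equation is monic in the variable `k`, so it cannot vanish on the whole `k`-axis.
-/
theorem exists_mem_cosIdeal_eval_single_ne_zero (k : ι) :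
    ∃ G ∈ cosIdeal ι, ∃ c : ℂ, eval (Pi.single k c) G ≠ 0 := by
  let A := closedTuples ι → ℂ
  let y : ι → A := fun i t => cosPoint t.1 i
  let g : MvPolynomial {j // j ≠ k} ℂ →+* A := (aeval fun j : {j // j ≠ k} => y j).toRingHom
  algebraize [g]
  let u : ι → A := fun i t => t.1 i
  let v : ι → A := fun i t => (t.1 i)⁻¹
  have huv : ∀ i, u i * v i = 1 := fun i => funext fun t => mul_inv_cancel₀ (t.2.1 i)
  have hy : ∀ i, y i = algebraMap ℂ A (1 / 2) * (u i + v i) := fun i => funext fun t => by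
    simp [y, u, v, cosPoint, A]; ring
  have hsum : ∀ i, algebraMap ℂ A 2 * y i = u i + v i := fun i => funext fun t => by
    simp [y, u, v, cosPoint, A]; ring
  have hC : ∀ c : ℂ, IsIntegral (MvPolynomial {j // j ≠ k} ℂ) (algebraMap ℂ A c) := fun c => by
    have : algebraMap ℂ A c = algebraMap _ A (C c : MvPolynomial {j // j ≠ k} ℂ) := by
      change _ = g _
      simp [g]
    rw [this]; exact isIntegral_algebraMap
  have hroot : ∀ j, j ≠ k → ∀ w w' : A, w * w' = 1 → w + w' = algebraMap ℂ A 2 * y j →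
      IsIntegral (MvPolynomial {j // j ≠ k} ℂ) w := by
    intro j hj w w' h1 h2
    refine ⟨Polynomial.X ^ 2 - Polynomial.C (C 2 * X ⟨j, hj⟩) * Polynomial.X + 1,
      by monicity!, ?_⟩
    have : algebraMap (MvPolynomial {j // j ≠ k} ℂ) A (C 2 * X ⟨j, hj⟩) = w + w' := by
      rw [h2]; change g _ = _; simp [g]
    simp only [Polynomial.eval₂_add, Polynomial.eval₂_sub, Polynomial.eval₂_mul,
      Polynomial.eval₂_pow, Polynomial.eval₂_X, Polynomial.eval₂_C, this, Polynomial.eval₂_one]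
    linear_combination -h1
  have hu : ∀ j, j ≠ k → IsIntegral (MvPolynomial {j // j ≠ k} ℂ) (u j) := fun j hj =>
    hroot j hj (u j) (v j) (huv j) (hsum j).symm
  have hv : ∀ j, j ≠ k → IsIntegral (MvPolynomial {j // j ≠ k} ℂ) (v j) := fun j hj =>
    hroot j hj (v j) (u j) (by rw [mul_comm, huv j]) (by rw [hsum, add_comm])
  have hprod : ∏ j, u j = 1 := funext fun t => by rw [Finset.prod_apply]; exact t.2.2
  have hprod' : ∏ j, v j = 1 := funext fun t => by
    rw [Finset.prod_apply]
    change ∏ j, (t.1 j)⁻¹ = 1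
    rw [Finset.prod_inv_distrib, t.2.2, inv_one]
  have huk : u k = ∏ j ∈ Finset.univ.erase k, v j := by
    rw [← Finset.mul_prod_erase _ _ (Finset.mem_univ k)] at hprod'
    linear_combination (∏ j ∈ Finset.univ.erase k, v j) * huv k - (u k) * hprod'
  have hvk : v k = ∏ j ∈ Finset.univ.erase k, u j := by
    rw [← Finset.mul_prod_erase _ _ (Finset.mem_univ k)] at hprod
    linear_combination (∏ j ∈ Finset.univ.erase k, u j) * huv k - (v k) * hprod
  have hyk : IsIntegral (MvPolynomial {j // j ≠ k} ℂ) (y k) := by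
    rw [hy, huk, hvk]
    exact (hC _).mul ((IsIntegral.prod _ fun j hj => hv j (Finset.ne_of_mem_erase hj)).add
      (IsIntegral.prod _ fun j hj => hu j (Finset.ne_of_mem_erase hj)))
  obtain ⟨p, hp, hp0⟩ := hyk
  refine ⟨(splitVar k).symm p, mem_cosIdeal.2 fun t ht => ?_, ?_⟩
  · rw [← eval_splitVar k, AlgEquiv.apply_symm_apply, Polynomial.eval_map]
    have := congrArg (Pi.evalRingHom (fun _ : closedTuples ι => ℂ) ⟨t, ht⟩) hp0
    rw [Polynomial.hom_eval₂, map_zero] at this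
    have hring : (eval fun j : {j // j ≠ k} => cosPoint t j) =
        (Pi.evalRingHom (fun _ : closedTuples ι => ℂ) ⟨t, ht⟩).comp
          (algebraMap (MvPolynomial {j // j ≠ k} ℂ) A) := by
      refine MvPolynomial.ringHom_ext (fun c => ?_) (fun j => ?_)
      · change _ = g _ ⟨t, ht⟩
        simp [g, A]
      · change _ = g _ ⟨t, ht⟩
        simp [g, y]
    rw [hring]
    exact this
  · have hmon := hp.map (eval fun j : {j // j ≠ k} => (0 : ℂ))
    obtain ⟨c, hc⟩ : ∃ c, Polynomial.eval c (p.map (eval fun j : {j // j ≠ k} => (0 : ℂ))) ≠ 0 := by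
      by_contra! h
      exact hmon.ne_zero (Polynomial.funext fun c => by rw [h c]; simp)
    have hz : (fun j : {j // j ≠ k} => (Pi.single k c : ι → ℂ) j) = fun _ => 0 :=
      funext fun j => by simp [j.2]
    exact ⟨c, by rwa [← eval_splitVar k, AlgEquiv.apply_symm_apply, hz, Pi.single_eq_same]⟩

end Torus

end CycleCone

/-! ### Real angles, uniqueness of the cycle polynomial, and its sign symmetry -/

namespace CycleCone

open MvPolynomial

theorem eval_aeval {σ τ : Type*} (f : σ → MvPolynomial τ ℂ) (x : τ → ℂ) (P : MvPolynomial σ ℂ) :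
    eval x (aeval f P) = eval (fun i => eval x (f i)) P := by
  induction P using MvPolynomial.induction_on with
  | C a => simp
  | add p q hp hq => simp only [map_add, hp, hq]
  | mul_X p i hp => simp only [map_mul, hp, aeval_X, eval_X]

section Torus

variable {ι : Type*} [Fintype ι] [DecidableEq ι]

omit [Fintype ι] [DecidableEq ι] in
theorem cosPoint_exp (θ : ι → ℝ) :
    cosPoint (fun i => Complex.exp (θ i * Complex.I)) = toComplex fun i => Real.cos (θ i) := by
  funext i
  simp only [cosPoint, toComplex, Complex.ofReal_cos, Complex.cos, ← Complex.exp_neg, neg_mul]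

theorem cosPoint_closeUp_exp (k : ι) (θ : ι → ℝ) :
    cosPoint (closeUp k fun i => Complex.exp (θ i * Complex.I)) =
      toComplex (Function.update (fun i => Real.cos (θ i)) k
        (Real.cos (∑ j ∈ Finset.univ.erase k, θ j))) := by
  have : closeUp k (fun i => Complex.exp (θ i * Complex.I)) = fun i =>
      Complex.exp ((Function.update θ k (-∑ j ∈ Finset.univ.erase k, θ j) i : ℝ) * Complex.I) := by
    funext i
    by_cases h : i = k
    · subst h
      simp [closeUp, ← Complex.exp_sum, ← Complex.exp_neg, Finset.sum_mul, sub_mul]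
    · simp [closeUp, h]
  rw [this, cosPoint_exp]
  congr 1
  funext i
  by_cases h : i = k
  · subst h
    rw [Function.update_self, Function.update_self, Real.cos_neg]
  · simp [h]

theorem eval_update_cos_of_mem_cosIdeal (k : ι) {P : MvPolynomial ι ℂ} (hP : P ∈ cosIdeal ι)
    (θ : ι → ℝ) : eval (toComplex (Function.update (fun i => Real.cos (θ i)) k
        (Real.cos (∑ j ∈ Finset.univ.erase k, θ j)))) P = 0 := by
  rw [← cosPoint_closeUp_exp]
  exact mem_cosIdeal.1 hP _ (closeUp_mem k fun i _ => Complex.exp_ne_zero _)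

/-- An arc of the unit circle is infinite, so real angles are Zariski dense in the torus. The range
`[0, π]` is the one on which `arccos` inverts `cos`. -/
theorem mem_cosIdeal_of_eval_update_cos (k : ι) {P : MvPolynomial ι ℂ}
    (h : ∀ θ : ι → ℝ, (∀ i, θ i ∈ Set.Icc 0 Real.pi) →
      eval (toComplex (Function.update (fun i => Real.cos (θ i)) k
        (Real.cos (∑ j ∈ Finset.univ.erase k, θ j)))) P = 0) : P ∈ cosIdeal ι := by
  refine mem_cosIdeal_of_forall k
    (fun _ => (fun t : ℝ => Complex.exp (t * Complex.I)) '' Set.Icc 0 Real.pi) (fun _ => ?_) ?_ ?_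
  · refine (Set.Icc_infinite Real.pi_pos).image fun a ha b hb hab => ?_
    have := congrArg Complex.re hab
    simp only [Complex.exp_ofReal_mul_I_re] at this
    exact Real.injOn_cos ha hb this
  · rintro i _ ⟨t, -, rfl⟩
    exact Complex.exp_ne_zero _
  · intro u hu
    choose θ hθ hu using hu
    have : u = fun i => Complex.exp (θ i * Complex.I) := funext fun i => (hu i).symm
    rw [this, cosPoint_closeUp_exp]
    exact h θ hθ

/-- Over every point of `[-1, 1]` in the other coordinates, both polynomials vanish at the cosine of
the sum of the arccosines. -/
theorem dvd_of_mem_cosIdeal [Nonempty ι] {P f : MvPolynomial ι ℂ} (hP : Irreducible P)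
    (hPI : P ∈ cosIdeal ι) (hf : f ∈ cosIdeal ι) : P ∣ f := by
  obtain ⟨k⟩ := ‹Nonempty ι›
  refine dvd_of_common_zeros k hP (fun _ => Set.Icc (-1) 1)
    (fun _ => Set.Icc_infinite (by norm_num)) fun x hx =>
      ⟨Real.cos (∑ j ∈ Finset.univ.erase k, Real.arccos (x j)), ?_⟩
  have : Function.update x k (Real.cos (∑ j ∈ Finset.univ.erase k, Real.arccos (x j))) =
      Function.update (fun i => Real.cos (Real.arccos (x i))) k
        (Real.cos (∑ j ∈ Finset.univ.erase k, Real.arccos (x j))) := by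
    funext i
    by_cases h : i = k
    · subst h; simp
    · simp only [Function.update_of_ne h]
      rw [Real.cos_arccos (hx i h).1 (hx i h).2]
  rw [this]
  exact ⟨eval_update_cos_of_mem_cosIdeal k hPI _, eval_update_cos_of_mem_cosIdeal k hf _⟩

theorem exists_irreducible_mem_cosIdeal [Nonempty ι] : ∃ P ∈ cosIdeal ι, Irreducible P := by
  obtain ⟨k⟩ := ‹Nonempty ι›
  obtain ⟨G, hG, c, hc⟩ := exists_mem_cosIdeal_eval_single_ne_zero k
  have hne : cosIdeal ι ≠ ⊥ := fun h => by
    rw [h, Ideal.mem_bot] at hG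
    simp [hG] at hc
  have : Nonempty ι := ⟨k⟩
  obtain ⟨P, hP, hp⟩ := Ideal.IsPrime.exists_mem_prime_of_ne_bot
    (inferInstance : (cosIdeal ι).IsPrime) hne
  exact ⟨P, hP, hp.irreducible⟩

theorem exists_eq_C_mul_of_associated {σ : Type*} {P Q : MvPolynomial σ ℂ} (h : Associated P Q) :
    ∃ c : ℂ, c ≠ 0 ∧ Q = C c * P := by
  obtain ⟨u, hu⟩ := h
  obtain ⟨c, hc, hcu⟩ := MvPolynomial.isUnit_iff_eq_C_of_isReduced.1 u.isUnit
  exact ⟨c, hc.ne_zero, by rw [← hu, hcu, mul_comm]⟩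

theorem exists_eval_single_ne_zero [Nonempty ι] {P : MvPolynomial ι ℂ} (hP : Irreducible P)
    (hPI : P ∈ cosIdeal ι) (k : ι) : ∃ c : ℂ, eval (Pi.single k c) P ≠ 0 := by
  obtain ⟨G, hG, c, hc⟩ := exists_mem_cosIdeal_eval_single_ne_zero k
  obtain ⟨R, rfl⟩ := dvd_of_mem_cosIdeal hP hPI hG
  exact ⟨c, fun h => hc (by rw [map_mul, h, zero_mul])⟩

/-- Change the sign of the variables `i` and `j`. -/
noncomputable def flip (i j : ι) : MvPolynomial ι ℂ →ₐ[ℂ] MvPolynomial ι ℂ :=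
  aeval fun l => C (if l = i ∨ l = j then -1 else 1) * X l

omit [Fintype ι] in
theorem eval_flip (i j : ι) (x : ι → ℂ) (P : MvPolynomial ι ℂ) :
    eval x (flip i j P) = eval (fun l => (if l = i ∨ l = j then -1 else 1) * x l) P := by
  rw [flip, eval_aeval]
  simp

omit [Fintype ι] in
theorem flip_flip (i j : ι) (P : MvPolynomial ι ℂ) : flip i j (flip i j P) = P :=
  MvPolynomial.funext fun x => by
    rw [eval_flip, eval_flip]
    congr 2
    funext l
    split_ifs <;> simp

theorem flip_mem_cosIdeal {i j : ι} (hij : i ≠ j) {P : MvPolynomial ι ℂ} (hP : P ∈ cosIdeal ι) :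
    flip i j P ∈ cosIdeal ι := by
  refine mem_cosIdeal.2 fun u hu => ?_
  rw [eval_flip]
  have : (fun l => (if l = i ∨ l = j then -1 else 1) * cosPoint u l) =
      cosPoint fun l => (if l = i ∨ l = j then -1 else 1) * u l := by
    funext l
    simp only [cosPoint]
    split_ifs
    · simp; ring
    · simp
  rw [this]
  refine mem_cosIdeal.1 hP _ ⟨fun l => ?_, ?_⟩
  · have := hu.1 l
    dsimp only
    split_ifs <;> simpa
  · rw [Finset.prod_mul_distrib, hu.2, mul_one, Finset.prod_ite, Finset.prod_const_one, mul_one,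
      Finset.prod_const]
    have : (Finset.univ.filter fun l => l = i ∨ l = j) = {i, j} := by ext; simp
    rw [this, Finset.card_pair hij]
    norm_num

/-- The flip preserves `cosIdeal`, so it multiplies `P` by a constant. The third index `k` shows
that the constant is `1`: the flip fixes the `k`-axis pointwise, and `P` does not vanish identically
there. -/
theorem flip_eq_self {P : MvPolynomial ι ℂ} (hP : Irreducible P) (hPI : P ∈ cosIdeal ι)
    {i j k : ι} (hij : i ≠ j) (hi : k ≠ i) (hj : k ≠ j) : flip i j P = P := by
  have : Nonempty ι := ⟨k⟩
  obtain ⟨R, hR⟩ := dvd_of_mem_cosIdeal hP hPI (flip_mem_cosIdeal hij hPI)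
  have hRR : flip i j R * R = 1 := by
    have := congrArg (flip i j) hR
    rw [flip_flip, map_mul, hR] at this
    exact mul_left_cancel₀ hP.ne_zero (by linear_combination -this)
  obtain ⟨c, -, rfl⟩ := MvPolynomial.isUnit_iff_eq_C_of_isReduced.1 (IsUnit.of_mul_eq_one_right _ hRR)
  obtain ⟨a, ha⟩ := exists_eval_single_ne_zero hP hPI k
  have h1 := congrArg (eval (Pi.single k a)) hR
  rw [eval_flip, map_mul, eval_C] at h1
  have h2 : (fun l => (if l = i ∨ l = j then -1 else 1) * (Pi.single k a : ι → ℂ) l) =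
      Pi.single k a := by
    funext l
    by_cases h : l = k
    · subst h; simp [hi, hj]
    · simp [h]
  rw [h2] at h1
  have hc : c = 1 := mul_left_cancel₀ ha (by linear_combination -h1)
  rw [hR, hc, map_one, mul_one]

theorem coeff_flip (i j : ι) (hij : i ≠ j) (P : MvPolynomial ι ℂ) (α : ι →₀ ℕ) :
    coeff α (flip i j P) = (-1) ^ (α i + α j) * coeff α P := by
  induction P using MvPolynomial.induction_on' with
  | monomial β a =>
    have h1 : (β.prod fun l e => (C (if l = i ∨ l = j then -1 else 1) * X l :
        MvPolynomial ι ℂ) ^ e) =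
        C ((-1) ^ (β i + β j)) * β.prod fun l e => (X l : MvPolynomial ι ℂ) ^ e := by
      simp only [mul_pow, Finsupp.prod_mul]
      congr 1
      rw [Finsupp.prod_fintype _ _ fun _ => pow_zero _, Fintype.prod_eq_mul i j hij]
      · simp [pow_add]
      · rintro l ⟨h1, h2⟩
        simp [h1, h2]
    rw [flip, aeval_monomial, h1, algebraMap_eq, mul_left_comm, ← monomial_eq, coeff_C_mul,
      coeff_monomial]
    split_ifs with h
    · rw [h]
    · simp
  | add p q hp hq => rw [map_add, coeff_add, coeff_add, hp, hq, mul_add]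

theorem even_add_of_coeff_ne_zero {P : MvPolynomial ι ℂ} (hP : Irreducible P)
    (hPI : P ∈ cosIdeal ι) {i j k : ι} (hij : i ≠ j) (hi : k ≠ i) (hj : k ≠ j) {α : ι →₀ ℕ}
    (hα : coeff α P ≠ 0) : Even (α i + α j) := by
  by_contra h
  have := coeff_flip i j hij P α
  rw [flip_eq_self hP hPI hij hi hj, (Nat.not_even_iff_odd.1 h).neg_one_pow] at this
  exact hα (by linear_combination this / 2)

end Torus

theorem isCyclePolynomial_iff {m : ℕ} [NeZero m] {P : MvPolynomial (Fin m) ℂ} :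
    IsCyclePolynomial m P ↔ Irreducible P ∧ P ∈ cosIdeal (Fin m) := by
  refine and_congr_right fun _ => ⟨fun h => ?_, fun h x hx h0 => ?_⟩
  · refine mem_cosIdeal_of_eval_update_cos 0 fun θ hθ => h _ (fun i hi => ?_) ?_
    · simp only [Function.update_of_ne hi]
      exact Real.cos_mem_Icc _
    · rw [Function.update_self]
      congr 1
      refine Finset.sum_congr rfl fun i hi => ?_
      rw [Function.update_of_ne (Finset.ne_of_mem_erase hi), Real.arccos_cos (hθ i).1 (hθ i).2]
  · have := eval_update_cos_of_mem_cosIdeal 0 h fun i => Real.arccos (x i)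
    rw [← h0] at this
    have hx' : Function.update (fun i => Real.cos (Real.arccos (x i))) 0 (x 0) = x := by
      funext i
      by_cases hi : i = 0
      · subst hi; simp
      · rw [Function.update_of_ne hi, Real.cos_arccos (hx i hi).1 (hx i hi).2]
    rwa [hx'] at this

theorem exists_isCyclePolynomial (m : ℕ) [NeZero m] :
    ∃ P : MvPolynomial (Fin m) ℂ, IsCyclePolynomial m P := by
  obtain ⟨P, hP, hirr⟩ := exists_irreducible_mem_cosIdeal (ι := Fin m)
  exact ⟨P, isCyclePolynomial_iff.2 ⟨hirr, hP⟩⟩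

theorem IsCyclePolynomial.unique {m : ℕ} [NeZero m] {P P' : MvPolynomial (Fin m) ℂ}
    (h : IsCyclePolynomial m P) (h' : IsCyclePolynomial m P') :
    ∃ c : ℂ, c ≠ 0 ∧ P' = C c * P := by
  rw [isCyclePolynomial_iff] at h h'
  exact exists_eq_C_mul_of_associated (associated_of_dvd_dvd
    (dvd_of_mem_cosIdeal h.1 h.2 h'.2) (dvd_of_mem_cosIdeal h'.1 h'.2 h.2))

end CycleCone

/-! ### The substitution and the numerator -/

namespace CycleCone

open MvPolynomial

variable {m : ℕ} [NeZero m]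

/-- The monomial `∏ᵢ s_{i,i}^N`. -/
noncomputable def diagMonomial (m N : ℕ) : MvPolynomial (Fin m ⊕ Fin m) ℂ :=
  ∏ i : Fin m, X (Sum.inl i) ^ N

omit [NeZero m] in
theorem eval_diagMonomial (N : ℕ) (s : Fin m ⊕ Fin m → ℂ) :
    eval s (diagMonomial m N) = ∏ i : Fin m, s (Sum.inl i) ^ N := by
  simp [diagMonomial]

omit [NeZero m] in
theorem eval_diagMonomial_ne_zero (N : ℕ) {s : Fin m ⊕ Fin m → ℂ} (hs : ∀ i, s (Sum.inl i) ≠ 0) :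
    eval s (diagMonomial m N) ≠ 0 := by
  rw [eval_diagMonomial]
  exact Finset.prod_ne_zero_iff.2 fun i _ => pow_ne_zero _ (hs i)

omit [NeZero m] in
theorem diagMonomial_ne_zero (m N : ℕ) : diagMonomial m N ≠ 0 := fun h =>
  eval_diagMonomial_ne_zero (m := m) N (s := 1) (by simp) (by rw [h, map_zero])

omit [NeZero m] in
theorem toComplex_inl_ne_zero {s : Fin m ⊕ Fin m → ℝ} (hs : ∀ i, 0 < s (Sum.inl i)) (i : Fin m) :
    toComplex s (Sum.inl i) ≠ 0 :=
  Complex.ofReal_ne_zero.2 (hs i).ne'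

omit [NeZero m] in
theorem eq_of_eval_pos {P Q : MvPolynomial (Fin m ⊕ Fin m) ℂ}
    (h : ∀ s : Fin m ⊕ Fin m → ℝ, (∀ i, 0 < s (Sum.inl i)) →
      eval (toComplex s) P = eval (toComplex s) Q) : P = Q := by
  rw [← sub_eq_zero]
  refine eq_zero_of_eval_real (fun _ => Set.Ioi 0) (fun _ => Set.Ioi_infinite 0) fun s hs => ?_
  rw [map_sub, h s fun i => hs _, sub_self]

/-- The factor `√a` at vertex `i + 1` comes from the edges `i` and `i + 1`, hence with exponent `α i
+ α (i + 1)`, which is even. -/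
theorem prod_sqrt_pow {a : Fin m → ℝ} (ha : ∀ i, 0 < a i) {α e : Fin m → ℕ}
    (he : ∀ i, α i + α (i + 1) = 2 * e (i + 1)) :
    ∏ i, Real.sqrt (a i * a (i + 1)) ^ α i = ∏ i, a i ^ e i := by
  have h1 : ∀ i, Real.sqrt (a i * a (i + 1)) ^ α i =
      Real.sqrt (a i) ^ α i * Real.sqrt (a (i + 1)) ^ α i := fun i => by
    rw [Real.sqrt_mul (ha i).le, mul_pow]
  simp only [h1]
  rw [Finset.prod_mul_distrib, ← Equiv.prod_comp (Equiv.addRight (1 : Fin m)),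
    ← Equiv.prod_comp (Equiv.addRight (1 : Fin m)) (fun i => a i ^ e i), ← Finset.prod_mul_distrib]
  refine Finset.prod_congr rfl fun i _ => ?_
  simp only [Equiv.coe_addRight]
  rw [← pow_add, add_comm (α _), he, pow_mul, Real.sq_sqrt (ha _).le]

theorem exists_eval_normalize_monomial {α : Fin m →₀ ℕ} (hα : ∀ i, Even (α i + α (i + 1)))
    (c : ℂ) : ∃ (N : ℕ) (Q : MvPolynomial (Fin m ⊕ Fin m) ℂ),
      ∀ s : Fin m ⊕ Fin m → ℝ, (∀ i, 0 < s (Sum.inl i)) → eval (toComplex s) Q =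
        eval (toComplex s) (diagMonomial m N) *
          eval (toComplex (normalize m s)) (monomial α c) := by
  choose e' he' using fun i => (hα i).two_dvd
  let e : Fin m → ℕ := fun i => e' (i - 1)
  have he : ∀ i, α i + α (i + 1) = 2 * e (i + 1) := fun i => by simp [e, he']
  -- The sum `∑ e i` serves only as a common upper bound for the exponents `e i` of the denominator.
  refine ⟨∑ i, e i, C c * ((∏ i, X (Sum.inr i) ^ α i) * ∏ i, X (Sum.inl i) ^ ((∑ j, e j) - e i)),
    fun s hs => ?_⟩
  have h1 := prod_sqrt_pow (a := fun i => s (Sum.inl i)) hs he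
  have h2 : ∏ i, s (Sum.inl i) ^ (∑ j, e j) =
      (∏ i, s (Sum.inl i) ^ ((∑ j, e j) - e i)) * ∏ i, s (Sum.inl i) ^ e i := by
    rw [← Finset.prod_mul_distrib]
    refine Finset.prod_congr rfl fun i _ => ?_
    rw [← pow_add, Nat.sub_add_cancel (Finset.single_le_sum (fun _ _ => Nat.zero_le _)
      (Finset.mem_univ i))]
  have h3 : (∏ i, s (Sum.inl i) ^ (∑ j, e j)) * ∏ i, normalize m s i ^ α i =
      (∏ i, s (Sum.inr i) ^ α i) * ∏ i, s (Sum.inl i) ^ ((∑ j, e j) - e i) := by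
    simp only [normalize, div_pow]
    rw [Finset.prod_div_distrib, h1, h2]
    have : ∏ i, s (Sum.inl i) ^ e i ≠ 0 :=
      Finset.prod_ne_zero_iff.2 fun i _ => pow_ne_zero _ (hs i).ne'
    field_simp
  have h4 := congrArg (fun x : ℝ => (x : ℂ)) h3
  push_cast at h4
  rw [eval_diagMonomial, eval_monomial, Finsupp.prod_fintype _ _ fun _ => pow_zero _]
  simp only [map_mul, eval_C, map_prod, map_pow, eval_X, toComplex]
  rw [← h4]
  ring

theorem IsCyclePolynomial.exists_eval_normalize {P : MvPolynomial (Fin m) ℂ}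
    (hP : IsCyclePolynomial m P) (hm : 3 ≤ m) :
    ∃ (N : ℕ) (Q : MvPolynomial (Fin m ⊕ Fin m) ℂ),
      ∀ s : Fin m ⊕ Fin m → ℝ, (∀ i, 0 < s (Sum.inl i)) → eval (toComplex s) Q =
        eval (toComplex s) (diagMonomial m N) * eval (toComplex (normalize m s)) P := by
  rw [isCyclePolynomial_iff] at hP
  have heven : ∀ α, coeff α P ≠ 0 → ∀ i, Even (α i + α (i + 1)) := fun α hα i => by
    have h1 : i ≠ i + 1 := by
      rw [ne_eq, left_eq_add, Fin.ext_iff, Fin.val_one', Nat.mod_eq_of_lt (by omega)]; simp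
    obtain ⟨k, hk⟩ : ∃ k, k ∉ ({i, i + 1} : Finset (Fin m)) := by
      by_contra! h
      have := Finset.card_le_card (fun k _ => h k : Finset.univ ⊆ ({i, i + 1} : Finset (Fin m)))
      have h2 := Finset.card_le_two (a := i) (b := i + 1)
      simp only [Finset.card_univ, Fintype.card_fin] at this
      omega
    simp only [Finset.mem_insert, Finset.mem_singleton, not_or] at hk
    exact even_add_of_coeff_ne_zero hP.1 hP.2 h1 hk.1 hk.2 hα
  rw [← support_sum_monomial_coeff P]
  refine Finset.sum_induction _ (fun R => ∃ (N : ℕ) (Q : MvPolynomial (Fin m ⊕ Fin m) ℂ),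
      ∀ s : Fin m ⊕ Fin m → ℝ, (∀ i, 0 < s (Sum.inl i)) → eval (toComplex s) Q =
        eval (toComplex s) (diagMonomial m N) * eval (toComplex (normalize m s)) R) ?_ ?_ ?_
  · rintro R S ⟨N, Q, hQ⟩ ⟨N', Q', hQ'⟩
    refine ⟨N + N', diagMonomial m N' * Q + diagMonomial m N * Q', fun s hs => ?_⟩
    have : diagMonomial m (N + N') = diagMonomial m N * diagMonomial m N' := by
      simp only [diagMonomial, pow_add, Finset.prod_mul_distrib]
    rw [this, map_add, map_mul, map_mul, map_mul, map_add, hQ s hs, hQ' s hs]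
    ring
  · exact ⟨0, 0, fun s _ => by simp⟩
  · intro α hα
    exact exists_eval_normalize_monomial (heven α (mem_support_iff.1 hα)) _

theorem IsCyclePolynomial.exists_isNumerator {P : MvPolynomial (Fin m) ℂ}
    (hP : IsCyclePolynomial m P) (hm : 3 ≤ m) : ∃ Γ, IsNumerator m P Γ := by
  obtain ⟨N, Q, hQ⟩ := hP.exists_eval_normalize hm
  obtain ⟨Γ, D, c, hrel, hc, hcD⟩ := UniqueFactorizationMonoid.exists_reduced_factors' Q
    (diagMonomial m N) (diagMonomial_ne_zero m N)
  refine ⟨Γ, D, fun h => diagMonomial_ne_zero m N (by rw [← hcD, h, mul_zero]), hrel,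
    fun s hs => ?_⟩
  have h1 := hQ s hs
  have h2 := eval_diagMonomial_ne_zero N (toComplex_inl_ne_zero hs)
  rw [← hcD, map_mul] at h2
  rw [← hc, ← hcD, map_mul, map_mul] at h1
  exact mul_left_cancel₀ (left_ne_zero_of_mul h2) (by linear_combination h1)

theorem IsNumerator.unique {P : MvPolynomial (Fin m) ℂ} {Γ Γ' : MvPolynomial (Fin m ⊕ Fin m) ℂ}
    (h : IsNumerator m P Γ) (h' : IsNumerator m P Γ') : ∃ c : ℂ, c ≠ 0 ∧ Γ' = C c * Γ := by
  obtain ⟨D, -, hrel, hD⟩ := h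
  obtain ⟨D', -, hrel', hD'⟩ := h'
  have key : Γ * D' = Γ' * D := eq_of_eval_pos fun s hs => by
    rw [map_mul, map_mul, hD s hs, hD' s hs]; ring
  exact exists_eq_C_mul_of_associated (associated_of_dvd_dvd
    (hrel.dvd_of_dvd_mul_right (Dvd.intro _ key)) (hrel'.dvd_of_dvd_mul_right (Dvd.intro _ key.symm)))

/-- The denominator of a cycle polynomial in the coordinates `s` is a monomial in the `s_{i,i}`. -/
theorem IsNumerator.exists_dvd_diagMonomial {P : MvPolynomial (Fin m) ℂ}
    {Γ : MvPolynomial (Fin m ⊕ Fin m) ℂ} (hP : IsCyclePolynomial m P) (hm : 3 ≤ m)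
    (h : IsNumerator m P Γ) : ∃ (D : MvPolynomial (Fin m ⊕ Fin m) ℂ) (N : ℕ),
      D ∣ diagMonomial m N ∧ IsRelPrime Γ D ∧
      ∀ s : Fin m ⊕ Fin m → ℝ, (∀ i, 0 < s (Sum.inl i)) →
        eval (toComplex s) Γ = eval (toComplex s) D * eval (toComplex (normalize m s)) P := by
  obtain ⟨N, Q, hQ⟩ := hP.exists_eval_normalize hm
  obtain ⟨D, -, hrel, hD⟩ := h
  refine ⟨D, N, ?_, hrel, hD⟩
  have key : Γ * diagMonomial m N = D * Q := eq_of_eval_pos fun s hs => by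
    rw [map_mul, map_mul, hD s hs, hQ s hs]; ring
  exact hrel.symm.dvd_of_dvd_mul_left (Dvd.intro _ key.symm)

end CycleCone

/-! ### Irreducibility of the numerator -/

namespace CycleCone

open MvPolynomial

section Cover

variable {m : ℕ} [NeZero m]

/-- The statistics `s_{i,i} = tᵢ²` and `s_{i,i+1} = xᵢ tᵢ tᵢ₊₁`. -/
def cover {R : Type*} [CommRing R] (v : Fin m ⊕ Fin m → R) : Fin m ⊕ Fin m → R :=
  Sum.elim (fun i => v (Sum.inl i) ^ 2)
    (fun i => v (Sum.inr i) * v (Sum.inl i) * v (Sum.inl (i + 1)))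

/-- The substitution `s_{i,i} = tᵢ²`, `s_{i,i+1} = xᵢ tᵢ tᵢ₊₁` in polynomials. -/
noncomputable def coverHom (m : ℕ) [NeZero m] :
    MvPolynomial (Fin m ⊕ Fin m) ℂ →ₐ[ℂ] MvPolynomial (Fin m ⊕ Fin m) ℂ :=
  aeval (cover X)

theorem eval_coverHom (v : Fin m ⊕ Fin m → ℂ) (f : MvPolynomial (Fin m ⊕ Fin m) ℂ) :
    eval v (coverHom m f) = eval (cover v) f := by
  rw [coverHom, eval_aeval]
  congr 2
  funext i
  cases i <;> simp [cover]

theorem toComplex_cover (v : Fin m ⊕ Fin m → ℝ) : toComplex (cover v) = cover (toComplex v) := by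
  funext i
  cases i <;> simp [cover, toComplex]

theorem normalize_cover {v : Fin m ⊕ Fin m → ℝ} (hv : ∀ i, 0 < v (Sum.inl i)) :
    normalize m (cover v) = fun i => v (Sum.inr i) := by
  funext i
  have h1 := hv i
  have h2 := hv (i + 1)
  simp only [normalize, cover, Sum.elim_inl, Sum.elim_inr]
  rw [← mul_pow, Real.sqrt_sq (mul_pos h1 h2).le]
  field_simp

theorem exists_cover_eq {s : Fin m ⊕ Fin m → ℂ} (hs : ∀ i, s (Sum.inl i) ≠ 0) :
    ∃ v, cover v = s := by
  choose t ht using fun i => IsAlgClosed.exists_pow_nat_eq (s (Sum.inl i)) (two_pos)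
  have ht0 : ∀ i, t i ≠ 0 := fun i h => hs i (by rw [← ht i, h]; simp)
  refine ⟨Sum.elim t fun i => s (Sum.inr i) / (t i * t (i + 1)), ?_⟩
  funext i
  cases i with
  | inl i => simp [cover, ht]
  | inr i =>
    have h1 := ht0 i
    have h2 := ht0 (i + 1)
    simp only [cover, Sum.elim_inl, Sum.elim_inr]
    field_simp

theorem prime_rename_inr {σ τ : Type*} {P : MvPolynomial τ ℂ} (hP : Prime P) :
    Prime (rename (Sum.inr : τ → σ ⊕ τ) P) := by
  have h : sumAlgEquiv ℂ σ τ (rename Sum.inr P) = C P :=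
    DFunLike.congr_fun (sumAlgEquiv_comp_rename_inr (R := ℂ) (S₁ := σ) (S₂ := τ)) P
  rw [← MulEquiv.prime_iff (sumAlgEquiv ℂ σ τ), h]
  exact (prime_C_iff σ).2 hP

end Cover

section Irreducible

variable {m : ℕ} [NeZero m] {P : MvPolynomial (Fin m) ℂ} {Γ D : MvPolynomial (Fin m ⊕ Fin m) ℂ}
  {N : ℕ}

theorem coverHom_numerator (h : ∀ s : Fin m ⊕ Fin m → ℝ, (∀ i, 0 < s (Sum.inl i)) →
      eval (toComplex s) Γ = eval (toComplex s) D * eval (toComplex (normalize m s)) P) :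
    coverHom m Γ = coverHom m D * rename Sum.inr P := by
  refine eq_of_eval_pos fun v hv => ?_
  rw [map_mul, eval_coverHom, eval_coverHom, eval_rename, ← toComplex_cover,
    h _ fun i => pow_pos (hv i) 2, normalize_cover hv]
  rfl

theorem not_X_inl_dvd_numerator (hP : P ≠ 0) (hD : D ∣ diagMonomial m N) (hrel : IsRelPrime Γ D)
    (h : coverHom m Γ = coverHom m D * rename Sum.inr P) (i : Fin m) : ¬ X (Sum.inl i) ∣ Γ := by
  intro hX
  have hirr : Irreducible (X (Sum.inl i) : MvPolynomial (Fin m ⊕ Fin m) ℂ) :=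
    (X_prime).irreducible
  have hXD : ¬ X (Sum.inl i) ∣ D := fun h' => hirr.not_isUnit (hrel hX h')
  have hD' : D ∣ ∏ j ∈ Finset.univ.erase i, X (Sum.inl j) ^ N := by
    rw [diagMonomial, ← Finset.mul_prod_erase _ _ (Finset.mem_univ i)] at hD
    exact ((hirr.isRelPrime_iff_not_dvd.2 hXD).symm.pow_right).dvd_of_dvd_mul_left hD
  obtain ⟨x, hx⟩ : ∃ x, eval x P ≠ 0 := by
    by_contra! h
    exact hP (MvPolynomial.funext fun x => by rw [h x, map_zero])
  -- At `tᵢ = 0` a numerator divisible by `s_{i,i}` vanishes, whereas `D`, now dividing a monomial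
  -- in the other diagonal variables, and `P` do not.
  let v : Fin m ⊕ Fin m → ℂ := Sum.elim (fun j => if j = i then 0 else 1) x
  have h1 := congrArg (eval v) h
  obtain ⟨R, hR⟩ := hX
  obtain ⟨S, hS⟩ := hD'
  rw [map_mul, eval_coverHom, eval_coverHom, eval_rename, hR, map_mul, eval_X] at h1
  have h2 : cover v (Sum.inl i) = 0 := by simp [cover, v]
  rw [h2, zero_mul] at h1
  have h3 : eval (cover v) D = 0 := (mul_eq_zero.1 h1.symm).resolve_right hx
  have h4 := congrArg (eval (cover v)) hS
  rw [map_mul, h3, zero_mul, map_prod] at h4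
  refine Finset.prod_ne_zero_iff.2 (fun j hj => ?_) h4
  simp [cover, v, Finset.ne_of_mem_erase hj]

/-- Once `P` is cancelled, the pullback of `B` divides that of `D`. Points with nonzero diagonal
lift to the cover, so `B` vanishes only where some `s_{i,i}` does. By the Nullstellensatz any
irreducible factor of `B` is some `s_{i,i}`, and none of these divides `Γ`. -/
theorem isUnit_of_dvd_left (hP : P ≠ 0) (hD : D ∣ diagMonomial m N) (hrel : IsRelPrime Γ D)
    (h : coverHom m Γ = coverHom m D * rename Sum.inr P) {A B : MvPolynomial (Fin m ⊕ Fin m) ℂ}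
    (hΓ : Γ = A * B) (hA : rename Sum.inr P ∣ coverHom m A) : IsUnit B := by
  have hP' : rename (Sum.inr : Fin m → Fin m ⊕ Fin m) P ≠ 0 := fun h0 =>
    hP (rename_injective _ Sum.inr_injective (by rw [h0, map_zero]))
  obtain ⟨g, hg⟩ := hA
  have hDB : coverHom m D = g * coverHom m B := by
    rw [hΓ, map_mul, hg] at h
    exact mul_left_cancel₀ hP' (by linear_combination -h)
  have hB : ∀ s : Fin m ⊕ Fin m → ℂ, eval s B = 0 → eval s (diagMonomial m 1) = 0 := by
    intro s hs
    by_contra hne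
    have hne' : ∀ i, s (Sum.inl i) ≠ 0 := by
      rw [eval_diagMonomial, ← ne_eq, Finset.prod_ne_zero_iff] at hne
      simpa using hne
    obtain ⟨v, rfl⟩ := exists_cover_eq hne'
    have h1 := congrArg (eval v) hDB
    rw [map_mul, eval_coverHom, eval_coverHom, hs, mul_zero] at h1
    obtain ⟨S, hS⟩ := hD
    exact eval_diagMonomial_ne_zero N hne' (by rw [hS, map_mul, h1, zero_mul])
  have hrad : diagMonomial m 1 ∈ (Ideal.span {B}).radical := by
    rw [← vanishingIdeal_zeroLocus_eq_radical (K := ℂ), mem_vanishingIdeal_iff]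
    intro s hs
    exact hB s (by simpa [zeroLocus_span, aeval_eq_eval] using hs)
  obtain ⟨n, hn⟩ := hrad
  rw [Ideal.mem_span_singleton] at hn
  by_contra hu
  have hB0 : B ≠ 0 := by
    rintro rfl
    exact pow_ne_zero n (diagMonomial_ne_zero m 1) (zero_dvd_iff.1 hn)
  obtain ⟨p, hp, hpB⟩ := WfDvdMonoid.exists_irreducible_factor hu hB0
  have hp1 : p ∣ diagMonomial m 1 := hp.prime.dvd_of_dvd_pow (hpB.trans hn)
  obtain ⟨i, -, hi⟩ := (hp.prime.dvd_finsetProd_iff _).1 hp1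
  have hpX : p ∣ X (Sum.inl i) := hp.prime.dvd_of_dvd_pow hi
  have hXp : X (Sum.inl i) ∣ p := (hp.associated_of_dvd (X_prime).irreducible hpX).symm.dvd
  exact not_X_inl_dvd_numerator hP hD hrel h i
    (hXp.trans (hpB.trans (hΓ ▸ Dvd.intro_left A rfl)))

theorem eval_cos_of_mem_cosIdeal {ι : Type*} [Fintype ι] {P : MvPolynomial ι ℂ}
    (hP : P ∈ cosIdeal ι) (θ : ι → ℝ) (hθ : Complex.exp ((∑ i, θ i : ℝ) * Complex.I) = 1) :
    eval (toComplex fun i => Real.cos (θ i)) P = 0 := by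
  rw [← cosPoint_exp]
  refine mem_cosIdeal.1 hP _ ⟨fun i => Complex.exp_ne_zero _, ?_⟩
  rw [← hθ, ← Complex.exp_sum, ← Finset.sum_mul]
  push_cast
  rfl

theorem normalize_elim_one (x : Fin m → ℝ) : normalize m (Sum.elim (fun _ => 1) x) = x := by
  funext i
  simp [normalize]

/-- The statistics of a regular polygon. -/
noncomputable def regularPoint (m : ℕ) : Fin m ⊕ Fin m → ℝ :=
  Sum.elim (fun _ => 1) (fun _ => Real.cos (2 * Real.pi / m))

/-- The `m` angles `2π / m` close up. This zero shows that `Γ` is not a unit and, since the edge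
minors are nonzero there for `m ≥ 3`, that `Γ` divides none of them. -/
theorem IsNumerator.eval_regularPoint (hP : IsCyclePolynomial m P) (hΓ : IsNumerator m P Γ) :
    eval (toComplex (regularPoint m)) Γ = 0 := by
  obtain ⟨D, -, -, h⟩ := hΓ
  have hm : (m : ℂ) ≠ 0 := Nat.cast_ne_zero.2 (NeZero.ne m)
  rw [h _ (fun i => by simp [regularPoint]), regularPoint, normalize_elim_one,
    eval_cos_of_mem_cosIdeal (isCyclePolynomial_iff.1 hP).2 fun _ => 2 * Real.pi / m, mul_zero]
  rw [← Complex.exp_two_pi_mul_I]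
  congr 1
  simp only [Finset.sum_const, Finset.card_univ, Fintype.card_fin, nsmul_eq_mul]
  push_cast
  field_simp

theorem IsNumerator.irreducible (hm : 3 ≤ m) (hP : IsCyclePolynomial m P)
    (hΓ : IsNumerator m P Γ) : Irreducible Γ := by
  obtain ⟨D, N, hD, hrel, h⟩ := hΓ.exists_dvd_diagMonomial hP hm
  have hcov := coverHom_numerator h
  refine ⟨fun hu => ?_, fun {A B} hAB => ?_⟩
  · have h1 := hu.map (eval (toComplex (regularPoint m)))
    rw [hΓ.eval_regularPoint hP] at h1
    exact not_isUnit_zero h1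
  · have hprime : Prime (rename (Sum.inr : Fin m → Fin m ⊕ Fin m) P) := prime_rename_inr hP.1.prime
    have hdvd : rename Sum.inr P ∣ coverHom m A * coverHom m B := by
      rw [← map_mul, ← hAB, hcov]
      exact Dvd.intro_left _ rfl
    rcases hprime.dvd_or_dvd hdvd with hA | hB
    · exact Or.inr (isUnit_of_dvd_left hP.1.ne_zero hD hrel hcov hAB hA)
    · exact Or.inl (isUnit_of_dvd_left hP.1.ne_zero hD hrel hcov (hAB.trans (mul_comm A B)) hB)

end Irreducible

section EdgeMinor

variable {m : ℕ} [NeZero m]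

theorem eval_edgeMinor (i : Fin m) (s : Fin m ⊕ Fin m → ℂ) : eval s (edgeMinor m i) =
    s (Sum.inl i) * s (Sum.inl (i + 1)) - s (Sum.inr i) ^ 2 := by
  simp [edgeMinor]

end EdgeMinor

end CycleCone

/-! ### Edge minors and coprimality of the factors -/

namespace CycleCone

open MvPolynomial

section EdgeMinor

variable {m : ℕ} [NeZero m]

theorem ne_add_one (hm : 2 ≤ m) (i : Fin m) : i ≠ i + 1 := by
  rw [ne_eq, left_eq_add, Fin.ext_iff, Fin.val_one', Nat.mod_eq_of_lt (by omega)]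
  simp

/-- The minor has degree one in `s_{i,i}`, with coprime coefficients `s_{i+1,i+1}` and
`-s_{i,i+1}²`. -/
theorem irreducible_edgeMinor (hm : 2 ≤ m) (i : Fin m) : Irreducible (edgeMinor m i) := by
  rw [← MulEquiv.irreducible_iff (splitVar (Sum.inl i : Fin m ⊕ Fin m))]
  have h1 : (Sum.inl (i + 1) : Fin m ⊕ Fin m) ≠ Sum.inl i := by simpa using (ne_add_one hm i).symm
  have h2 : (Sum.inr i : Fin m ⊕ Fin m) ≠ Sum.inl i := by simp
  have hX : ∀ j (hj : j ≠ Sum.inl i), splitVar (Sum.inl i : Fin m ⊕ Fin m) (X j) =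
      Polynomial.C (X ⟨j, hj⟩) := fun j hj => by
    simp [splitVar, Equiv.optionSubtypeNe_symm_of_ne hj]
  have hX' : splitVar (Sum.inl i : Fin m ⊕ Fin m) (X (Sum.inl i)) = Polynomial.X := by
    simp [splitVar]
  have : splitVar (Sum.inl i : Fin m ⊕ Fin m) (edgeMinor m i) =
      Polynomial.C (X ⟨_, h1⟩) * Polynomial.X + Polynomial.C (-X ⟨_, h2⟩ ^ 2) := by
    rw [edgeMinor, map_sub, map_mul, map_pow, hX', hX _ h1, hX _ h2, map_neg, map_pow]
    ring
  rw [this]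
  refine Polynomial.irreducible_C_mul_X_add_C (X_ne_zero _) ?_
  rw [IsRelPrime.neg_right_iff]
  refine IsRelPrime.pow_right ((X_prime.irreducible.isRelPrime_iff_not_dvd).2 fun h => ?_)
  rw [X_dvd_X] at h
  simp at h

theorem not_dvd_of_eval {σ : Type*} {P Q : MvPolynomial σ ℂ} (s : σ → ℂ) (hP : eval s P = 0)
    (hQ : eval s Q ≠ 0) : ¬ P ∣ Q := by
  rintro ⟨R, rfl⟩
  exact hQ (by rw [map_mul, hP, zero_mul])

theorem not_edgeMinor_dvd_edgeMinor {i j : Fin m} (h : i ≠ j) :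
    ¬ edgeMinor m i ∣ edgeMinor m j := by
  refine not_dvd_of_eval (Sum.elim (fun _ => 1) (Pi.single i 1)) ?_ ?_
  · simp [eval_edgeMinor]
  · simp [eval_edgeMinor, h.symm]

theorem eval_edgeMinor_regularPoint (hm : 3 ≤ m) (i : Fin m) :
    eval (toComplex (regularPoint m)) (edgeMinor m i) ≠ 0 := by
  have hm' : (3 : ℝ) ≤ m := by exact_mod_cast hm
  have hlt : 2 * Real.pi / m < Real.pi := by
    rw [div_lt_iff₀ (by linarith)]
    nlinarith [Real.pi_pos]
  have hs : 0 < Real.sin (2 * Real.pi / m) :=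
    Real.sin_pos_of_pos_of_lt_pi (by positivity) hlt
  have : eval (toComplex (regularPoint m)) (edgeMinor m i) =
      ((Real.sin (2 * Real.pi / m) ^ 2 : ℝ) : ℂ) := by
    rw [eval_edgeMinor, Real.sin_sq]
    simp [toComplex, regularPoint]
  rw [this, Complex.ofReal_ne_zero]
  positivity

theorem boundaryPolynomial_dvd (hm : 3 ≤ m) {P : MvPolynomial (Fin m) ℂ}
    {Γ f : MvPolynomial (Fin m ⊕ Fin m) ℂ} (hP : IsCyclePolynomial m P) (hΓ : IsNumerator m P Γ)
    (h1 : Γ ∣ f) (h2 : ∀ i, edgeMinor m i ∣ f) : boundaryPolynomial m Γ ∣ f := by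
  have hirr := hΓ.irreducible hm hP
  refine IsRelPrime.mul_dvd (IsRelPrime.prod_right fun i _ => ?_) h1
    (Fintype.prod_dvd_of_isRelPrime (fun i j hij => ?_) h2)
  · exact hirr.isRelPrime_iff_not_dvd.2
      (not_dvd_of_eval _ (hΓ.eval_regularPoint hP) (eval_edgeMinor_regularPoint hm i))
  · exact (irreducible_edgeMinor (by omega) i).isRelPrime_iff_not_dvd.2
      (not_edgeMinor_dvd_edgeMinor hij)

end EdgeMinor

end CycleCone

/-! ### Convexity, openness, and semidefinite completions on the closure -/

namespace CycleCone

section Convex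

variable {m : ℕ} [NeZero m]

theorem suffStat_add (S T : Matrix (Fin m) (Fin m) ℝ) :
    suffStat m (S + T) = suffStat m S + suffStat m T := by
  funext i; cases i <;> rfl

theorem suffStat_smul (c : ℝ) (S : Matrix (Fin m) (Fin m) ℝ) :
    suffStat m (c • S) = c • suffStat m S := by
  funext i; cases i <;> rfl

theorem continuous_suffStat : Continuous (suffStat m) := by
  refine continuous_pi fun i => ?_
  cases i with
  | inl i => exact continuous_id.matrix_elem i i
  | inr i => exact continuous_id.matrix_elem i (i + 1)

theorem cone_nonempty (m : ℕ) [NeZero m] : (cone m).Nonempty :=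
  ⟨_, 1, Matrix.PosDef.one, rfl⟩

theorem smul_mem_cone {s : Fin m ⊕ Fin m → ℝ} (hs : s ∈ cone m) {c : ℝ} (hc : 0 < c) :
    c • s ∈ cone m := by
  obtain ⟨S, hS, rfl⟩ := hs
  exact ⟨c • S, Matrix.PosDef.smul hS hc, suffStat_smul c S⟩

theorem convex_cone (m : ℕ) [NeZero m] : Convex ℝ (cone m) := by
  rw [convex_iff_forall_pos]
  rintro _ ⟨S, hS, rfl⟩ _ ⟨T, hT, rfl⟩ a b ha hb -
  exact ⟨a • S + b • T, (Matrix.PosDef.smul hS ha).add (Matrix.PosDef.smul hT hb), by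
    rw [suffStat_add, suffStat_smul, suffStat_smul]⟩

theorem suffStat_mem_closure_cone {S : Matrix (Fin m) (Fin m) ℝ} (hS : S.PosSemidef) :
    suffStat m S ∈ closure (cone m) := by
  have h1 : Filter.Tendsto (fun ε : ℝ => suffStat m (S + ε • 1)) (nhdsWithin 0 (Set.Ioi 0))
      (nhds (suffStat m S)) := by
    have : Continuous fun ε : ℝ => suffStat m (S + ε • 1) := continuous_suffStat.comp (by fun_prop)
    have h := (this.tendsto 0).mono_left (nhdsWithin_le_nhds (s := Set.Ioi (0 : ℝ)))
    simpa using h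
  refine mem_closure_of_tendsto h1 ?_
  filter_upwards [self_mem_nhdsWithin] with ε hε
  exact ⟨_, Matrix.PosDef.posSemidef_add hS (Matrix.PosDef.smul Matrix.PosDef.one hε), rfl⟩

theorem quadForm_eq_sum {n : Type*} [Fintype n] (M : Matrix n n ℝ) (x : n → ℝ) :
    star x ⬝ᵥ (M.mulVec x) = ∑ i, ∑ j, x i * M i j * x j := by
  simp [dotProduct, Matrix.mulVec, Finset.mul_sum, mul_assoc]

theorem posSemidef_of_sum_nonneg {n : Type*} [Fintype n] {M : Matrix n n ℝ}
    (hsymm : ∀ i j, M i j = M j i) (h : ∀ x : n → ℝ, 0 ≤ ∑ i, ∑ j, x i * M i j * x j) :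
    M.PosSemidef :=
  Matrix.PosSemidef.of_dotProduct_mulVec_nonneg (by ext i j; simp [hsymm i j])
    fun x => by rw [quadForm_eq_sum]; exact h x

theorem abs_quadForm_le {n : Type*} [Fintype n] (M : Matrix n n ℝ) (x : n → ℝ) {c : ℝ}
    (hc : ∀ i j, |M i j| ≤ c) :
    |∑ i, ∑ j, x i * M i j * x j| ≤ c * (∑ i, |x i|) ^ 2 := by
  rw [sq, Finset.sum_mul_sum, Finset.mul_sum]
  refine (Finset.abs_sum_le_sum_abs _ _).trans (Finset.sum_le_sum fun i _ => ?_)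
  rw [Finset.mul_sum]
  refine (Finset.abs_sum_le_sum_abs _ _).trans (Finset.sum_le_sum fun j _ => ?_)
  rw [abs_mul, abs_mul]
  nlinarith [mul_nonneg (abs_nonneg (x i)) (abs_nonneg (x j)), hc i j]

theorem exists_posDef_add {n : Type*} [Fintype n] {S : Matrix n n ℝ} (hS : S.PosDef) :
    ∃ ε > 0, ∀ T : Matrix n n ℝ, T.IsHermitian → (∀ i j, |T i j| ≤ ε) → (S + T).PosDef := by
  have hS' : ∀ x : n → ℝ, x ≠ 0 → 0 < ∑ i, ∑ j, x i * S i j * x j := fun x hx => by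
    rw [← quadForm_eq_sum]; exact hS.dotProduct_mulVec_pos hx
  obtain ⟨c, hc, hcS⟩ : ∃ c > 0, ∀ x : n → ℝ, ‖x‖ = 1 → c ≤ ∑ i, ∑ j, x i * S i j * x j := by
    rcases (Metric.sphere (0 : n → ℝ) 1).eq_empty_or_nonempty with h | h
    · refine ⟨1, one_pos, fun x hx => ?_⟩
      have : x ∈ Metric.sphere (0 : n → ℝ) 1 := by simpa using hx
      simp [h] at this
    · obtain ⟨x, hx, hmin⟩ := (isCompact_sphere (0 : n → ℝ) 1).exists_isMinOn h
        (f := fun x => ∑ i, ∑ j, x i * S i j * x j) (by fun_prop)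
      refine ⟨_, hS' x ?_, fun y hy => hmin (by simpa using hy)⟩
      rintro rfl
      simp at hx
  let N : ℝ := Fintype.card n
  -- On the unit sphere of the sup norm `∑ |yᵢ| ≤ N`, so `T` changes the form by less than its
  -- minimum `c`. The `+ 1` covers empty `n`.
  refine ⟨c / (2 * (N ^ 2 + 1)), by positivity, fun T hT hTε =>
    Matrix.PosDef.of_dotProduct_mulVec_pos (hS.1.add hT) fun x hx => ?_⟩
  have hx0 : 0 < ‖x‖ := norm_pos_iff.2 hx
  let y := ‖x‖⁻¹ • x
  have hy : ‖y‖ = 1 := by simp [y, norm_smul, hx0.ne']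
  have hsum : ∑ i, |y i| ≤ N := by
    calc ∑ i, |y i| ≤ ∑ _i : n, (1 : ℝ) :=
          Finset.sum_le_sum fun i _ => (norm_le_pi_norm y i).trans hy.le
      _ = N := by simp [N]
  have h0 : 0 ≤ ∑ i, |y i| := Finset.sum_nonneg fun i _ => abs_nonneg _
  have h1 := abs_quadForm_le T y hTε
  have h2 : c / (2 * (N ^ 2 + 1)) * (∑ i, |y i|) ^ 2 < c := by
    rw [div_mul_eq_mul_div, div_lt_iff₀ (by positivity)]
    have : (∑ i, |y i|) ^ 2 ≤ N ^ 2 := pow_le_pow_left₀ h0 hsum 2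
    nlinarith
  have h3 := hcS y hy
  have h4 : 0 < ∑ i, ∑ j, y i * (S + T) i j * y j := by
    have : ∑ i, ∑ j, y i * (S + T) i j * y j =
        ∑ i, ∑ j, y i * S i j * y j + ∑ i, ∑ j, y i * T i j * y j := by
      simp only [← Finset.sum_add_distrib, Matrix.add_apply]
      exact Finset.sum_congr rfl fun i _ => Finset.sum_congr rfl fun j _ => by ring
    rw [this]
    linarith [neg_abs_le (∑ i, ∑ j, y i * T i j * y j)]
  rw [quadForm_eq_sum]
  have h5 : ∑ i, ∑ j, x i * (S + T) i j * x j =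
      ‖x‖ ^ 2 * ∑ i, ∑ j, y i * (S + T) i j * y j := by
    simp only [Finset.mul_sum, y, Pi.smul_apply, smul_eq_mul]
    exact Finset.sum_congr rfl fun i _ => Finset.sum_congr rfl fun j _ => by field_simp
  rw [h5]
  positivity

/-- The symmetric matrix supported on the cycle with given statistics. -/
def cycleMatrix (s : Fin m ⊕ Fin m → ℝ) : Matrix (Fin m) (Fin m) ℝ := fun i j =>
  if i = j then s (Sum.inl i) else if j = i + 1 then s (Sum.inr i) else
    if i = j + 1 then s (Sum.inr j) else 0

theorem add_one_add_one_ne (hm : 3 ≤ m) (i : Fin m) : i + 1 + 1 ≠ i := by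
  intro h
  rw [add_assoc, add_eq_left, Fin.ext_iff, Fin.val_add, Fin.val_one',
    Nat.mod_eq_of_lt (by omega : 1 < m), Nat.mod_eq_of_lt (by omega : 1 + 1 < m)] at h
  simp at h

theorem cycleMatrix_isHermitian (hm : 3 ≤ m) (s : Fin m ⊕ Fin m → ℝ) :
    (cycleMatrix s).IsHermitian := by
  ext i j
  simp only [Matrix.conjTranspose_apply, star_trivial, cycleMatrix]
  by_cases h : i = j
  · subst h; simp
  · rw [if_neg h, if_neg (Ne.symm h)]
    by_cases h1 : j = i + 1
    · subst h1
      simp [(add_one_add_one_ne hm i).symm]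
    · simp [h1]

theorem suffStat_cycleMatrix (hm : 2 ≤ m) (s : Fin m ⊕ Fin m → ℝ) :
    suffStat m (cycleMatrix s) = s := by
  funext i
  cases i with
  | inl i => simp [suffStat, cycleMatrix]
  | inr i =>
    have := ne_add_one hm i
    simp only [suffStat, cycleMatrix, Sum.elim_inr, if_neg this, if_true]

theorem isOpen_cone (hm : 3 ≤ m) : IsOpen (cone m) := by
  rw [Metric.isOpen_iff]
  rintro _ ⟨S, hS, rfl⟩
  obtain ⟨ε, hε, h⟩ := exists_posDef_add hS
  refine ⟨ε, hε, fun s hs => ⟨S + cycleMatrix (s - suffStat m S),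
    h _ (cycleMatrix_isHermitian hm _) fun i j => ?_, ?_⟩⟩
  · rw [Metric.mem_ball, dist_eq_norm] at hs
    have h1 : ∀ k, |(s - suffStat m S) k| ≤ ε := fun k => (norm_le_pi_norm _ k).trans hs.le
    simp only [cycleMatrix]
    split_ifs
    · exact h1 _
    · exact h1 _
    · exact h1 _
    · simpa using hε.le
  · rw [suffStat_add, suffStat_cycleMatrix (by omega)]
    simp

theorem isClosed_posSemidef (n : Type*) [Fintype n] : IsClosed {S : Matrix n n ℝ | S.PosSemidef} := by
  simp only [Matrix.posSemidef_iff_dotProduct_mulVec, Set.ofPred_and, Set.ofPred_forall,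
    quadForm_eq_sum]
  refine IsClosed.inter (isClosed_eq (by fun_prop) continuous_id) (isClosed_iInter fun x => ?_)
  exact isClosed_le continuous_const (by fun_prop)

open scoped MatrixOrder Matrix.Norms.L2Operator in
theorem exists_gram_eq {n : Type*} [Fintype n] {S : Matrix n n ℝ} (hS : S.PosSemidef) :
    ∃ v : n → EuclideanSpace ℝ n, S = Matrix.gram ℝ v := by
  classical
  obtain ⟨B, rfl⟩ := CStarAlgebra.nonneg_iff_eq_star_mul_self.mp hS.nonneg
  refine ⟨fun i => WithLp.toLp 2 fun k => B k i, ?_⟩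
  ext i j
  simp [Matrix.mul_apply, Matrix.star_eq_conjTranspose, PiLp.inner_apply, mul_comm]

theorem abs_apply_le_of_posSemidef {n : Type*} [Fintype n] {S : Matrix n n ℝ}
    (hS : S.PosSemidef) (i j : n) : |S i j| ≤ S i i + S j j := by
  obtain ⟨v, rfl⟩ := exists_gram_eq hS
  simp only [Matrix.gram_apply, real_inner_self_eq_norm_sq]
  have := abs_real_inner_le_norm (v i) (v j)
  nlinarith [sq_nonneg (‖v i‖ - ‖v j‖), sq_nonneg (‖v i‖), sq_nonneg ‖v j‖]

theorem exists_posSemidef_of_mem_closure_cone {s : Fin m ⊕ Fin m → ℝ} (hs : s ∈ closure (cone m)) :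
    ∃ S : Matrix (Fin m) (Fin m) ℝ, S.PosSemidef ∧ suffStat m S = s := by
  -- Diagonal entries below `R` bound all entries of a semidefinite matrix, so the completions near
  -- `s` lie in a compact set. The `+ 1` makes the bound strict, so that it holds on an open
  -- neighbourhood of `s`.
  let R : ℝ := ∑ i, |s (Sum.inl i)| + 1
  have hR : ∀ i, s (Sum.inl i) < R := fun i => by
    have := Finset.single_le_sum (f := fun i => |s (Sum.inl i)|) (fun i _ => abs_nonneg _)
      (Finset.mem_univ i)
    have := le_abs_self (s (Sum.inl i))
    simp only [R]
    linarith
  let K : Set (Matrix (Fin m) (Fin m) ℝ) :=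
    {S | S.PosSemidef} ∩ Set.pi Set.univ fun _ => Set.pi Set.univ fun _ => Set.Icc (-(2 * R)) (2 * R)
  have hK : IsCompact K := (isCompact_univ_pi fun _ => isCompact_univ_pi fun _ =>
    isCompact_Icc).inter_left (isClosed_posSemidef _)
  let U : Set (Fin m ⊕ Fin m → ℝ) := {x | ∀ i, x (Sum.inl i) < R}
  have hU : IsOpen U := by
    simp only [U, Set.ofPred_forall]
    exact isOpen_iInter_of_finite fun i => isOpen_lt (continuous_apply _) continuous_const
  have hsub : U ∩ cone m ⊆ suffStat m '' K := by
    rintro _ ⟨hxU, S, hS, rfl⟩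
    refine ⟨S, ⟨hS.posSemidef, fun i _ j _ => ?_⟩, rfl⟩
    have h1 := abs_apply_le_of_posSemidef hS.posSemidef i j
    have h2 : S i i < R := hxU i
    have h3 : S j j < R := hxU j
    rw [Set.mem_Icc, ← abs_le]
    linarith
  have h := hU.inter_closure ⟨fun i => hR i, hs⟩
  obtain ⟨S, hS, hSs⟩ := (hK.image continuous_suffStat).isClosed.closure_subset_iff.2 hsub h
  exact ⟨S, hS.1, hSs⟩

/-- A supporting functional at a boundary point. -/
theorem exists_supporting_functional (hm : 3 ≤ m) {s : Fin m ⊕ Fin m → ℝ}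
    (hs : s ∈ coneBoundary m) : ∃ f : (Fin m ⊕ Fin m → ℝ) →L[ℝ] ℝ,
      (∀ x ∈ cone m, f x < 0) ∧ (∀ x ∈ closure (cone m), f x ≤ 0) ∧ f s = 0 := by
  obtain ⟨f, hf⟩ := geometric_hahn_banach_open_point (convex_cone m) (isOpen_cone hm) hs.2
  -- The cone is stable under positive scaling: a positive value of `f` could be scaled beyond `f
  -- s`, and below, if `f s < 0`, a negative value could be scaled to equal `f s`.
  have h0 : ∀ x ∈ cone m, f x ≤ 0 := fun x hx => by
    by_contra! hpos
    have := hf _ (smul_mem_cone hx (c := (|f s| + 1) / f x) (by positivity))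
    rw [map_smul, smul_eq_mul, div_mul_cancel₀ _ hpos.ne'] at this
    linarith [le_abs_self (f s)]
  have h1 : ∀ x ∈ closure (cone m), f x ≤ 0 := fun x hx =>
    closure_minimal (s := cone m) (t := {x | f x ≤ 0}) h0
      (isClosed_le f.continuous continuous_const) hx
  have h2 : 0 ≤ f s := by
    obtain ⟨x, hx⟩ := cone_nonempty m
    by_contra! hneg
    rcases (h0 x hx).lt_or_eq with hx0 | hx0
    · have := hf _ (smul_mem_cone hx (c := f s / f x) (div_pos_of_neg_of_neg hneg hx0))
      rw [map_smul, smul_eq_mul, div_mul_cancel₀ _ hx0.ne] at this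
      exact lt_irrefl _ this
    · linarith [hf x hx]
  have h3 := h1 s hs.1
  exact ⟨f, fun x hx => (hf x hx).trans_le h3, h1, le_antisymm h3 h2⟩

end Convex

end CycleCone

/-! ### The boundary lies in the hypersurface -/

namespace CycleCone

open MvPolynomial

section Boundary

variable {m : ℕ} [NeZero m]

omit [NeZero m] in
theorem functional_eq_sum (f : (Fin m ⊕ Fin m → ℝ) →L[ℝ] ℝ) (x : Fin m ⊕ Fin m → ℝ) :
    f x = ∑ i, f (Pi.single (Sum.inl i) 1) * x (Sum.inl i) +
      ∑ i, f (Pi.single (Sum.inr i) 1) * x (Sum.inr i) := by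
  have h := (f : (Fin m ⊕ Fin m → ℝ) →ₗ[ℝ] ℝ).pi_apply_eq_sum_univ x
  simp only [ContinuousLinearMap.coe_coe, Fintype.sum_sum_type, smul_eq_mul] at h
  rw [h]
  have hp : ∀ k : Fin m ⊕ Fin m, (fun j => if k = j then (1 : ℝ) else 0) = Pi.single k 1 := fun k => by
    funext j
    simp [Pi.single_apply, eq_comm]
  simp only [hp, mul_comm]

/-- Stationarity of a supporting functional along a Gram matrix. -/
theorem supporting_relation {E : Type*} [NormedAddCommGroup E] [InnerProductSpace ℝ E]
    {f : (Fin m ⊕ Fin m → ℝ) →L[ℝ] ℝ} (hf : ∀ x ∈ closure (cone m), f x ≤ 0)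
    {v : Fin m → E} (hv : f (suffStat m (Matrix.gram ℝ v)) = 0) (i : Fin m) :
    (2 * f (Pi.single (Sum.inl i) 1)) • v i + f (Pi.single (Sum.inr i) 1) • v (i + 1) +
      f (Pi.single (Sum.inr (i - 1)) 1) • v (i - 1) = 0 := by
  set r := (2 * f (Pi.single (Sum.inl i) 1)) • v i + f (Pi.single (Sum.inr i) 1) • v (i + 1) +
      f (Pi.single (Sum.inr (i - 1)) 1) • v (i - 1) with hr
  -- Only `vᵢ` is moved, in the direction of the expression `r` that should vanish; the first-order
  -- change of `f` is then `⟨r, r⟩`.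
  let p : Fin m → E := Pi.single i r
  let M : Matrix (Fin m) (Fin m) ℝ := Matrix.of fun j k =>
    inner ℝ (v j) (p k) + inner ℝ (p j) (v k)
  have hexp : ∀ t : ℝ, Matrix.gram ℝ (v + t • p) =
      Matrix.gram ℝ v + (t • M + (t ^ 2) • Matrix.gram ℝ p) := fun t => by
    ext j k
    simp only [Matrix.gram_apply, Pi.add_apply, Pi.smul_apply, inner_add_left, inner_add_right,
      real_inner_smul_left, real_inner_smul_right, Matrix.add_apply, Matrix.smul_apply, smul_eq_mul,
      M, Matrix.of_apply]
    ring
  have hle : ∀ t : ℝ, t * f (suffStat m M) + t ^ 2 * f (suffStat m (Matrix.gram ℝ p)) ≤ 0 :=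
    fun t => by
      have := hf _ (suffStat_mem_closure_cone (Matrix.posSemidef_gram ℝ (v + t • p)))
      rwa [hexp, suffStat_add, suffStat_add, suffStat_smul, suffStat_smul, map_add, map_add,
        map_smul, map_smul, hv, zero_add, smul_eq_mul, smul_eq_mul] at this
  have hM0 : f (suffStat m M) = 0 := by
    set α := f (suffStat m M)
    set β := f (suffStat m (Matrix.gram ℝ p))
    by_contra hα
    -- A step in the direction of `α`, short enough that `t² β` cannot outweigh `t α`.
    have h1 := hle (α / (|β| + 1))
    have hpos : 0 < |β| + 1 := by positivity
    have h2 : α / (|β| + 1) * α + (α / (|β| + 1)) ^ 2 * β =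
        α ^ 2 * (|β| + 1 + β) / (|β| + 1) ^ 2 := by
      field_simp
    rw [h2] at h1
    have h3 : 0 < |β| + 1 + β := by linarith [neg_abs_le β]
    have : 0 < α ^ 2 * (|β| + 1 + β) / (|β| + 1) ^ 2 := by positivity
    linarith
  have hfM : f (suffStat m M) = inner ℝ r r := by
    rw [functional_eq_sum]
    have h1 : ∑ j, f (Pi.single (Sum.inl j) 1) * suffStat m M (Sum.inl j) =
        2 * f (Pi.single (Sum.inl i) 1) * inner ℝ (v i) r := by
      rw [Finset.sum_eq_single i]
      · simp only [suffStat, Sum.elim_inl, M, Matrix.of_apply, p, Pi.single_eq_same, real_inner_comm]; ring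
      · intro j _ hj
        simp [suffStat, M, p, hj]
      · simp
    have h2 : ∑ j, f (Pi.single (Sum.inr j) 1) * suffStat m M (Sum.inr j) =
        f (Pi.single (Sum.inr i) 1) * inner ℝ (v (i + 1)) r +
          f (Pi.single (Sum.inr (i - 1)) 1) * inner ℝ (v (i - 1)) r := by
      simp only [suffStat, Sum.elim_inr, M, Matrix.of_apply, mul_add, Finset.sum_add_distrib]
      rw [add_comm]
      congr 1
      · rw [Finset.sum_eq_single i]
        · simp only [p, Pi.single_eq_same, real_inner_comm]
        · intro j _ hj
          simp [p, hj]
        · simp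
      · rw [Finset.sum_eq_single (i - 1)]
        · simp only [p, sub_add_cancel, Pi.single_eq_same]
        · intro j _ hj
          have : j + 1 ≠ i := fun h => hj (eq_sub_of_add_eq h)
          simp [p, this]
        · simp
    rw [h1, h2]
    conv_rhs => rw [hr]
    simp only [inner_add_left, real_inner_smul_left]
    ring
  exact inner_self_eq_zero.1 (hfM ▸ hM0)

/-- On the rank-one matrix of the vector with entries `1` at `j` and `y` at `j + 1`, the functional
is affine in `y` once the quadratic coefficient is zero. Being bounded above, it has slope zero. -/
theorem edge_coeff_eq_zero_of_diag_coeff_eq_zero (hm : 3 ≤ m)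
    {f : (Fin m ⊕ Fin m → ℝ) →L[ℝ] ℝ} (hf : ∀ x ∈ closure (cone m), f x ≤ 0) {j : Fin m}
    (hj : f (Pi.single (Sum.inl (j + 1)) 1) = 0) : f (Pi.single (Sum.inr j) 1) = 0 := by
  have hne := ne_add_one (by omega) j
  have hne' := add_one_add_one_ne hm j
  have key : ∀ y : ℝ, f (Pi.single (Sum.inl j) 1) + f (Pi.single (Sum.inr j) 1) * y ≤ 0 := by
    intro y
    let v : Fin m → ℝ := Pi.single j 1 + Pi.single (j + 1) y
    have hvj : v j = 1 := by simp [v, hne]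
    have hvj1 : v (j + 1) = y := by simp [v, hne.symm]
    have hv0 : ∀ i, i ≠ j → i ≠ j + 1 → v i = 0 := fun i h1 h2 => by simp [v, h1, h2]
    have h := hf _ (suffStat_mem_closure_cone (Matrix.posSemidef_gram ℝ v))
    rw [functional_eq_sum] at h
    have h1 : ∑ i, f (Pi.single (Sum.inl i) 1) * suffStat m (Matrix.gram ℝ v) (Sum.inl i) =
        f (Pi.single (Sum.inl j) 1) := by
      rw [Fintype.sum_eq_add j (j + 1) hne, hj, zero_mul, add_zero]
      · simp [suffStat, hvj]
      · rintro i ⟨h1, h2⟩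
        simp [suffStat, hv0 i h1 h2]
    have h2 : ∑ i, f (Pi.single (Sum.inr i) 1) * suffStat m (Matrix.gram ℝ v) (Sum.inr i) =
        f (Pi.single (Sum.inr j) 1) * y := by
      rw [Finset.sum_eq_single j]
      · simp [suffStat, hvj, hvj1]
      · intro i _ hi
        by_cases hi' : i = j + 1
        · have : v (i + 1) = 0 := hv0 _ (by rw [hi']; exact hne')
            (by rw [hi']; exact (ne_add_one (by omega) (j + 1)).symm)
          simp [suffStat, this]
        · simp [suffStat, hv0 i hi hi']
      · simp
    rwa [h1, h2] at h
  by_contra hb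
  have := key ((1 - f (Pi.single (Sum.inl j) 1)) / f (Pi.single (Sum.inr j) 1))
  rw [mul_div_cancel₀ _ hb] at this
  linarith

/-- The ratios `w (i + 1) / w i` of consecutive unit directions have the normalized edges as
cosines, and their product telescopes to `1` around the cycle. -/
theorem eval_normalize_of_planar {P : MvPolynomial (Fin m) ℂ} (hP : P ∈ cosIdeal (Fin m))
    {s : Fin m ⊕ Fin m → ℝ} {z : Fin m → ℂ} (hz : ∀ i, z i ≠ 0)
    (h1 : ∀ i, s (Sum.inl i) = ‖z i‖ ^ 2)
    (h2 : ∀ i, s (Sum.inr i) = (z i).re * (z (i + 1)).re + (z i).im * (z (i + 1)).im) :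
    eval (toComplex (normalize m s)) P = 0 := by
  let w : Fin m → ℂ := fun i => z i / ‖z i‖
  have hn : ∀ i, (‖z i‖ : ℂ) ≠ 0 := fun i => Complex.ofReal_ne_zero.2 (norm_ne_zero_iff.2 (hz i))
  have hw : ∀ i, w i ≠ 0 := fun i => div_ne_zero (hz i) (hn i)
  have hw1 : ∀ i, w i * (starRingEnd ℂ) (w i) = 1 := fun i => by
    simp only [w, map_div₀, Complex.conj_ofReal]
    rw [div_mul_div_comm, Complex.mul_conj', ← sq, div_self (pow_ne_zero 2 (hn i))]
  have hinv : ∀ i, (w i)⁻¹ = (starRingEnd ℂ) (w i) := fun i => inv_eq_of_mul_eq_one_right (hw1 i)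
  have heq : toComplex (normalize m s) = cosPoint fun i => w (i + 1) / w i := by
    funext i
    have hni := hn i
    have hni1 := hn (i + 1)
    simp only [toComplex, normalize, cosPoint, h1, h2]
    rw [← mul_pow, Real.sqrt_sq (by positivity), inv_div, div_eq_mul_inv (w (i + 1)),
      div_eq_mul_inv (w i), hinv, hinv]
    simp only [w, map_div₀, Complex.conj_ofReal]
    push_cast
    field_simp
    apply Complex.ext <;> simp <;> ring
  rw [heq]
  refine mem_cosIdeal.1 hP _ ⟨fun i => div_ne_zero (hw _) (hw _), ?_⟩
  have hshift := Equiv.prod_comp (Equiv.addRight (1 : Fin m)) w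
  simp only [Equiv.coe_addRight] at hshift
  rw [Finset.prod_div_distrib, hshift]
  exact div_self (Finset.prod_ne_zero_iff.2 fun i _ => hw i)

/-- Vectors that are all combinations of two independent vectors have planar coordinates. -/
theorem exists_planar_coordinates {E ι : Type*} [NormedAddCommGroup E] [InnerProductSpace ℝ E]
    {v : ι → E} {p q : E} (hq : ∀ c : ℝ, q ≠ c • p) (hp : p ≠ 0)
    (hv : ∀ i, v i ∈ Submodule.span ℝ {p, q}) :
    ∃ z : ι → ℂ, ∀ i j, inner ℝ (v i) (v j) = (z i).re * (z j).re + (z i).im * (z j).im := by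
  let e : E := ‖p‖⁻¹ • p
  let w : E := q - (inner ℝ e q) • e
  have hw : w ≠ 0 := fun h => hq (inner ℝ e q * ‖p‖⁻¹) (by rw [mul_smul]; exact sub_eq_zero.1 h)
  let g : E := ‖w‖⁻¹ • w
  have hp' : ‖p‖ ≠ 0 := norm_ne_zero_iff.2 hp
  have hw' : ‖w‖ ≠ 0 := norm_ne_zero_iff.2 hw
  have hee : inner ℝ e e = 1 := by
    rw [real_inner_self_eq_norm_sq, norm_smul, norm_inv, norm_norm, inv_mul_cancel₀ hp', one_pow]
  have hew : inner ℝ e w = 0 := by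
    simp only [w, inner_sub_right, real_inner_smul_right, hee, mul_one, sub_self]
  have heg : inner ℝ e g = 0 := by simp only [g, real_inner_smul_right, hew, mul_zero]
  have hge : inner ℝ g e = 0 := by rw [real_inner_comm, heg]
  have hgg : inner ℝ g g = 1 := by
    rw [real_inner_self_eq_norm_sq, norm_smul, norm_inv, norm_norm, inv_mul_cancel₀ hw', one_pow]
  have hpe : p = ‖p‖ • e + (0 : ℝ) • g := by simp [e, hp']
  have hqe : q = (inner ℝ e q) • e + ‖w‖ • g := by simp [g, w, hw']
  have hcoord : ∀ i, ∃ z : ℂ, v i = z.re • e + z.im • g := fun i => by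
    obtain ⟨a, b, hab⟩ := Submodule.mem_span_pair.1 (hv i)
    refine ⟨⟨a * ‖p‖ + b * inner ℝ e q, b * ‖w‖⟩, ?_⟩
    rw [← hab]
    conv_lhs => rw [hpe, hqe]
    module
  choose z hz using hcoord
  refine ⟨z, fun i j => ?_⟩
  rw [hz i, hz j]
  simp only [inner_add_left, inner_add_right, real_inner_smul_left, real_inner_smul_right, hee, heg,
    hge, hgg]
  ring

theorem forall_of_add_one {p : Fin m → Prop} {j : Fin m} (hj : p j) (h : ∀ i, p i → p (i + 1)) :
    ∀ i, p i := by
  have key : ∀ n : ℕ, p (j + Fin.ofNat m n) := by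
    intro n
    induction n with
    | zero => simpa using hj
    | succ n ih =>
      have := h _ ih
      convert this using 1
      rw [add_assoc]
      congr 1
      ext
      simp [Fin.val_add]
  intro i
  have := key (i - j).val
  simpa using this

theorem IsNumerator.eval_of_mem_coneBoundary (hm : 3 ≤ m) {P : MvPolynomial (Fin m) ℂ}
    {Γ : MvPolynomial (Fin m ⊕ Fin m) ℂ} (hP : IsCyclePolynomial m P) (hΓ : IsNumerator m P Γ)
    {s : Fin m ⊕ Fin m → ℝ} (hs : s ∈ coneBoundary m)
    (hminor : ∀ i, s (Sum.inl i) * s (Sum.inl (i + 1)) - s (Sum.inr i) ^ 2 ≠ 0) :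
    eval (toComplex s) Γ = 0 := by
  obtain ⟨S, hS, rfl⟩ := exists_posSemidef_of_mem_closure_cone hs.1
  obtain ⟨v, rfl⟩ := exists_gram_eq hS
  obtain ⟨f, hf, hf', hf0⟩ := exists_supporting_functional hm hs
  have hrel := supporting_relation hf' hf0
  have hmin : ∀ i, ‖v i‖ ^ 2 * ‖v (i + 1)‖ ^ 2 - inner ℝ (v i) (v (i + 1)) ^ 2 ≠ 0 := fun i => by
    have := hminor i
    simpa only [suffStat, Sum.elim_inl, Sum.elim_inr, Matrix.gram_apply,
      real_inner_self_eq_norm_sq] using this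
  have hv0 : ∀ i, v i ≠ 0 := fun i h => hmin i (by simp [h])
  have hpar : ∀ i, ∀ c : ℝ, v (i + 1) ≠ c • v i := fun i c h => hmin i (by
    rw [h, norm_smul, real_inner_smul_right, real_inner_self_eq_norm_sq, Real.norm_eq_abs, mul_pow,
      sq_abs]
    ring)
  set a : Fin m → ℝ := fun i => f (Pi.single (Sum.inl i) 1) with ha
  set b : Fin m → ℝ := fun i => f (Pi.single (Sum.inr i) 1) with hb
  -- If `b i = 0`, the relation at `i` makes `v i` a multiple of `v (i - 1)`, contrary to the
  -- nonzero minor.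
  have hab : ∀ i, a i ≠ 0 → b i ≠ 0 := fun i hai hbi => by
    have h := hrel i
    change (2 * a i) • v i + b i • v (i + 1) + b (i - 1) • v (i - 1) = 0 at h
    rw [hbi, zero_smul, add_zero] at h
    refine hpar (i - 1) (-(b (i - 1)) / (2 * a i)) ?_
    rw [sub_add_cancel, div_eq_inv_mul, mul_smul, neg_smul, ← eq_neg_of_add_eq_zero_left h,
      smul_smul, inv_mul_cancel₀ (by simpa using hai), one_smul]
  obtain ⟨j, hj⟩ : ∃ j, a j ≠ 0 := by
    by_contra! h
    have h1 := hf _ ⟨1, Matrix.PosDef.one, rfl⟩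
    rw [functional_eq_sum] at h1
    have h2 : ∀ i, suffStat m 1 (Sum.inr i) = 0 := fun i => by
      change (1 : Matrix (Fin m) (Fin m) ℝ) i (i + 1) = 0
      exact Matrix.one_apply_ne (ne_add_one (by omega) i)
    change ∑ i, a i * _ + ∑ i, b i * _ < 0 at h1
    simp [h, h2] at h1
  -- Nonvanishing propagates from `a i` to `b i` to `a (i + 1)`; then each relation expresses the
  -- next vector through the two before it.
  have hall : ∀ i, a i ≠ 0 := forall_of_add_one hj fun i hi h0 =>
    hab i hi (edge_coeff_eq_zero_of_diag_coeff_eq_zero hm hf' h0)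
  have hspan : ∀ i, v i ∈ Submodule.span ℝ {v 0, v 1} ∧
      v (i + 1) ∈ Submodule.span ℝ {v 0, v 1} := by
    refine forall_of_add_one (j := 0) ⟨Submodule.subset_span (by simp),
      Submodule.subset_span (by simp)⟩ fun i hi => ⟨hi.2, ?_⟩
    have h := hrel (i + 1)
    change (2 * a (i + 1)) • v (i + 1) + b (i + 1) • v (i + 1 + 1) + b (i + 1 - 1) • v (i + 1 - 1) = 0 at h
    rw [add_sub_cancel_right] at h
    have hbi := hab _ (hall (i + 1))
    have h2 : v (i + 1 + 1) = (b (i + 1))⁻¹ • (-((2 * a (i + 1)) • v (i + 1)) - b i • v i) := by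
      rw [eq_inv_smul_iff₀ hbi]
      rw [add_assoc, add_comm (b (i + 1) • v (i + 1 + 1)), ← add_assoc] at h
      rw [eq_neg_of_add_eq_zero_right h]
      abel
    rw [h2]
    exact Submodule.smul_mem _ _ (Submodule.sub_mem _ (Submodule.neg_mem _
      (Submodule.smul_mem _ _ hi.2)) (Submodule.smul_mem _ _ hi.1))
  obtain ⟨z, hz⟩ := exists_planar_coordinates (p := v 0) (q := v 1)
    (fun c => by simpa using hpar 0 c) (hv0 0) fun i => (hspan i).1
  have hzn : ∀ i, inner ℝ (v i) (v i) = ‖z i‖ ^ 2 := fun i => by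
    rw [hz, Complex.sq_norm, Complex.normSq_apply]
  have hz0 : ∀ i, z i ≠ 0 := fun i h => hv0 i (by
    have := hzn i
    rw [h, norm_zero, zero_pow two_ne_zero] at this
    exact inner_self_eq_zero.1 this)
  obtain ⟨D, -, -, hD⟩ := hΓ
  rw [hD _ fun i => ?_, eval_normalize_of_planar (isCyclePolynomial_iff.1 hP).2 hz0 hzn
    fun i => hz i (i + 1), mul_zero]
  change 0 < inner ℝ (v i) (v i)
  exact real_inner_self_pos.2 (hv0 i)

theorem eval_boundaryPolynomial_of_mem_coneBoundary (hm : 3 ≤ m) {P : MvPolynomial (Fin m) ℂ}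
    {Γ : MvPolynomial (Fin m ⊕ Fin m) ℂ} (hP : IsCyclePolynomial m P) (hΓ : IsNumerator m P Γ)
    {s : Fin m ⊕ Fin m → ℝ} (hs : s ∈ coneBoundary m) :
    eval (toComplex s) (boundaryPolynomial m Γ) = 0 := by
  rw [boundaryPolynomial, map_mul, map_prod]
  by_cases h : ∀ i, s (Sum.inl i) * s (Sum.inl (i + 1)) - s (Sum.inr i) ^ 2 ≠ 0
  · rw [hΓ.eval_of_mem_coneBoundary hm hP hs h, zero_mul]
  · push Not at h
    obtain ⟨i, hi⟩ := h
    rw [Finset.prod_eq_zero (Finset.mem_univ i), mul_zero]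
    rw [eval_edgeMinor]
    simp only [toComplex]
    exact_mod_cast hi

end Boundary

end CycleCone

/-! ### Divisibility by the edge minors -/

namespace CycleCone

open MvPolynomial

section Density

variable {m : ℕ} [NeZero m]

theorem edge_minor_pos_of_mem_cone (hm : 2 ≤ m) {s : Fin m ⊕ Fin m → ℝ} (hs : s ∈ cone m)
    (i : Fin m) : 0 < s (Sum.inl i) * s (Sum.inl (i + 1)) - s (Sum.inr i) ^ 2 := by
  obtain ⟨S, hS, rfl⟩ := hs
  have hinj : Function.Injective ![i, i + 1] := by
    have := ne_add_one hm i
    intro a b hab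
    fin_cases a <;> fin_cases b <;> simp_all
  have h := (hS.submatrix hinj).det_pos
  rw [Matrix.det_fin_two] at h
  have hsymm : S (i + 1) i = S i (i + 1) := by simpa using hS.1.apply i (i + 1)
  simp only [Matrix.submatrix_apply, Matrix.cons_val_zero, Matrix.cons_val_one, hsymm] at h
  simp only [suffStat, Sum.elim_inl, Sum.elim_inr]
  linarith

/-- Identify the vertex `k + 1` with `k`. -/
def contract (k i : Fin m) : Fin m := if i = k + 1 then k else i

theorem contract_eq_iff (k : Fin m) {l j : Fin m} (hl : l ≠ k) (hj : j ≠ k) :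
    contract k l = contract k j ↔ l = j := by
  unfold contract
  grind

theorem contract_ne_contract_add_one (hm : 3 ≤ m) (k : Fin m) {l : Fin m} (hl : l ≠ k) :
    contract k l ≠ contract k (l + 1) := by
  have h1 := fun i : Fin m => ne_add_one (by omega) i
  have h2 := fun i : Fin m => add_one_add_one_ne hm i
  have hinj : ∀ a b : Fin m, a + 1 = b + 1 → a = b := fun a b h => add_right_cancel h
  unfold contract
  intro h
  split_ifs at h with h3 h4 h4
  · exact hl (hinj _ _ h4)
  · exact h2 k (by rw [← h3, ← h])
  · exact hl h
  · exact h1 l h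

/-- This is where `m ≥ 4` is needed: contracting an edge of a triangle leaves two edges between the
same two vertices, whose values could not be prescribed independently. -/
theorem contract_edge_not_reversed (hm : 4 ≤ m) (k : Fin m) {l j : Fin m} (hl : l ≠ k)
    (hj : j ≠ k) : ¬ (contract k j = contract k (l + 1) ∧ contract k (j + 1) = contract k l) := by
  have h1 := fun i : Fin m => ne_add_one (by omega) i
  have h2 := fun i : Fin m => add_one_add_one_ne (by omega) i
  have h3 : ∀ i : Fin m, i + 1 + 1 + 1 ≠ i := by
    intro i h
    rw [add_assoc, add_assoc, add_eq_left, Fin.ext_iff, Fin.val_add, Fin.val_add, Fin.val_one',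
      Nat.mod_eq_of_lt (by omega : 1 < m), Nat.mod_eq_of_lt (by omega : 1 + 1 < m),
      Nat.mod_eq_of_lt (by omega : 1 + (1 + 1) < m)] at h
    simp at h
  have hinj : ∀ a b : Fin m, a + 1 = b + 1 → a = b := fun a b h => add_right_cancel h
  rintro ⟨ha, hb⟩
  unfold contract at ha hb
  split_ifs at ha hb <;> grind

/-- A positive semidefinite matrix whose vertices `k` and `k + 1` are identified and whose other
edges have prescribed small values. -/
theorem exists_posSemidef_contract (hm : 4 ≤ m) (k : Fin m) {x : Fin m → ℝ}
    (hx : ∀ j, j ≠ k → |x j| ≤ 1 / (2 * (m : ℝ) ^ 2)) :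
    ∃ M : Matrix (Fin m) (Fin m) ℝ, M.PosSemidef ∧ (∀ i, M i i = 1) ∧ M k (k + 1) = 1 ∧
      ∀ j, j ≠ k → M j (j + 1) = x j := by
  classical
  have hm0 : (0 : ℝ) < m := by exact_mod_cast (by omega : 0 < m)
  let y : Fin m → ℝ := fun j => if j = k then 0 else x j
  have hy : ∀ j, |y j| ≤ 1 / (2 * (m : ℝ) ^ 2) := fun j => by
    by_cases h : j = k
    · simp [y, h]
    · simpa [y, h] using hx j h
  let N : Matrix (Fin m) (Fin m) ℝ := Matrix.of fun a b => ∑ l, y l *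
    ((if a = contract k l ∧ b = contract k (l + 1) then 1 else 0) +
      (if b = contract k l ∧ a = contract k (l + 1) then 1 else 0))
  have hN : ∀ a b, N a b = ∑ l, y l *
      ((if a = contract k l ∧ b = contract k (l + 1) then 1 else 0) +
        (if b = contract k l ∧ a = contract k (l + 1) then 1 else 0)) := fun a b => by
    simp only [N, Matrix.of_apply]
  have hNsymm : ∀ a b, N a b = N b a := fun a b => by
    rw [hN, hN]
    exact Finset.sum_congr rfl fun l _ => by rw [add_comm]
  -- There are `m` summands of size at most `2 / (2 m²)`. By Cauchy–Schwarz, entries bounded by `1 /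
  -- m` keep `1 + N` semidefinite.
  have hNle : ∀ a b, |N a b| ≤ 1 / m := fun a b => by
    have : (1 : ℝ) / m = ∑ _l : Fin m, 1 / (2 * (m : ℝ) ^ 2) * 2 := by
      simp
      field_simp
    rw [this, hN]
    refine (Finset.abs_sum_le_sum_abs _ _).trans (Finset.sum_le_sum fun l _ => ?_)
    rw [abs_mul]
    refine mul_le_mul (hy l) ?_ (abs_nonneg _) (by positivity)
    split_ifs <;> norm_num
  have hNdiag : ∀ a, N a a = 0 := fun a => by
    rw [hN]
    refine Finset.sum_eq_zero fun l _ => ?_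
    by_cases hl : l = k
    · simp [y, hl]
    · have := contract_ne_contract_add_one (by omega) k hl
      rw [if_neg (fun h => this (h.1.symm.trans h.2))]
      simp
  have hNedge : ∀ j, j ≠ k → N (contract k j) (contract k (j + 1)) = x j := fun j hj => by
    rw [hN, Finset.sum_eq_single j]
    · rw [if_pos ⟨rfl, rfl⟩, if_neg]
      · simp [y, hj]
      · exact fun h => contract_ne_contract_add_one (by omega) k hj h.2
    · intro l _ hlj
      by_cases hl : l = k
      · simp [y, hl]
      · rw [if_neg, if_neg]
        · simp
        · exact fun h => contract_edge_not_reversed hm k hl hj ⟨h.2, h.1⟩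
        · exact fun h => hlj ((contract_eq_iff k hj hl).1 h.1).symm
    · simp
  have hPSD : (1 + N).PosSemidef := by
    refine posSemidef_of_sum_nonneg (fun a b => ?_) fun v => ?_
    · rw [Matrix.add_apply, Matrix.add_apply, hNsymm a b, Matrix.one_apply, Matrix.one_apply]
      simp only [eq_comm]
    · have h1 : ∑ i, ∑ j, v i * (1 + N) i j * v j = ∑ i, v i ^ 2 + ∑ i, ∑ j, v i * N i j * v j := by
        rw [← Finset.sum_add_distrib]
        refine Finset.sum_congr rfl fun i _ => ?_
        simp only [Matrix.add_apply, mul_add, add_mul, Finset.sum_add_distrib, Matrix.one_apply]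
        simp [sq]
      have h2 := abs_quadForm_le N v hNle
      have h3 : 1 / (m : ℝ) * (∑ i, |v i|) ^ 2 ≤ ∑ i, v i ^ 2 := by
        have := sq_sum_le_card_mul_sum_sq (s := Finset.univ) (f := fun i => |v i|)
        simp only [Finset.card_univ, Fintype.card_fin, sq_abs] at this
        rw [one_div, inv_mul_le_iff₀ hm0]
        exact this
      rw [h1]
      linarith [neg_abs_le (∑ i, ∑ j, v i * N i j * v j)]
  refine ⟨(1 + N).submatrix (contract k) (contract k), hPSD.submatrix _, fun i => ?_, ?_,
    fun j hj => ?_⟩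
  · simp [hNdiag]
  · have hk : contract k k = k := by unfold contract; split_ifs <;> rfl
    have hk1 : contract k (k + 1) = k := by simp [contract]
    simp [hk, hk1, hNdiag]
  · simp [hNedge j hj, Matrix.one_apply_ne (contract_ne_contract_add_one (by omega) k hj)]

theorem posSemidef_scale {n : Type*} [Fintype n] {M : Matrix n n ℝ} (hM : M.PosSemidef)
    (t : n → ℝ) : (Matrix.of fun i j => t i * t j * M i j).PosSemidef := by
  refine posSemidef_of_sum_nonneg (fun i j => ?_) fun x => ?_
  · have : M j i = M i j := by simpa using hM.1.apply i j
    simp only [Matrix.of_apply, this, mul_comm (t i)]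
  · have := hM.dotProduct_mulVec_nonneg fun i => x i * t i
    rw [quadForm_eq_sum] at this
    refine this.trans_eq (Finset.sum_congr rfl fun i _ => Finset.sum_congr rfl fun j _ => ?_)
    rw [Matrix.of_apply]
    ring

theorem edgeMinor_dvd (hm : 4 ≤ m) {f : MvPolynomial (Fin m ⊕ Fin m) ℂ}
    (hf : ∀ s ∈ coneBoundary m, eval (toComplex s) f = 0) (k : Fin m) : edgeMinor m k ∣ f := by
  have hm0 : (0 : ℝ) < m := by exact_mod_cast (by omega : 0 < m)
  have hδ : 0 < 1 / (2 * (m : ℝ) ^ 2) := by positivity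
  refine dvd_of_common_zeros (Sum.inr k) (irreducible_edgeMinor (by omega) k)
    (Sum.elim (fun _ => Set.Icc 1 2)
      fun _ => Set.Icc (-(1 / (2 * (m : ℝ) ^ 2))) (1 / (2 * (m : ℝ) ^ 2))) ?_ fun s hs => ?_
  · rintro (i | i)
    · exact Set.Icc_infinite (by norm_num)
    · exact Set.Icc_infinite (by linarith)
  let t : Fin m → ℝ := fun i => Real.sqrt (s (Sum.inl i))
  have hsl : ∀ i, 1 ≤ s (Sum.inl i) := fun i => (hs (Sum.inl i) (by simp)).1
  have ht : ∀ i, 1 ≤ t i := fun i => Real.one_le_sqrt.2 (hsl i)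
  have ht2 : ∀ i, t i * t i = s (Sum.inl i) := fun i =>
    Real.mul_self_sqrt (by linarith [hsl i])
  have htt : ∀ i, 1 ≤ t i * t (i + 1) := fun i => one_le_mul_of_one_le_of_one_le (ht _) (ht _)
  -- This value makes the minor at `k` vanish, which excludes the point from the cone; the
  -- contracted matrix, rescaled by `t`, puts it in the closure.
  let s' := Function.update s (Sum.inr k) (t k * t (k + 1))
  have hs'l : ∀ i, s' (Sum.inl i) = s (Sum.inl i) := fun i => by simp [s']
  have hs'k : s' (Sum.inr k) = t k * t (k + 1) := by simp [s']
  have hs'r : ∀ j, j ≠ k → s' (Sum.inr j) = s (Sum.inr j) := fun j hj => by simp [s', hj]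
  have hminor : s' (Sum.inl k) * s' (Sum.inl (k + 1)) - s' (Sum.inr k) ^ 2 = 0 := by
    rw [hs'k, hs'l, hs'l, ← ht2, ← ht2]
    ring
  obtain ⟨M, hM, hM1, hMk, hMj⟩ := exists_posSemidef_contract hm k
    (x := fun j => s (Sum.inr j) / (t j * t (j + 1))) fun j hj => by
      have h1 : |s (Sum.inr j)| ≤ 1 / (2 * (m : ℝ) ^ 2) := abs_le.2 (hs (Sum.inr j) (by simpa))
      rw [abs_div, abs_of_pos (by linarith [htt j] : 0 < t j * t (j + 1))]
      exact (div_le_self (abs_nonneg _) (htt j)).trans h1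
  have hbd : s' ∈ coneBoundary m := by
    refine ⟨?_, fun h => ?_⟩
    · have : suffStat m (Matrix.of fun i j => t i * t j * M i j) = s' := by
        funext i
        rcases i with i | i
        · simp [suffStat, hM1, hs'l, ht2]
        · simp only [suffStat, Sum.elim_inr, Matrix.of_apply]
          by_cases hi : i = k
          · subst hi
            rw [hMk, hs'k, mul_one]
          · rw [hMj i hi, hs'r i hi]
            rw [mul_div_assoc', mul_div_cancel_left₀ _ (zero_lt_one.trans_le (htt i)).ne']
      rw [← this]
      exact suffStat_mem_closure_cone (posSemidef_scale hM t)
    · exact (edge_minor_pos_of_mem_cone (by omega) h k).ne' hminor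
  refine ⟨t k * t (k + 1), ?_, hf _ hbd⟩
  rw [eval_edgeMinor]
  have := congrArg (fun x : ℝ => (x : ℂ)) hminor
  simp only [toComplex]
  push_cast at this
  exact this

end Density

end CycleCone

/-! ### Divisibility by the numerator, and the ideal of the boundary -/

namespace CycleCone

open MvPolynomial InnerProductGeometry

section Density

variable {m : ℕ} [NeZero m]

/-- The last vertex of the cycle, adjacent to the vertex `0`. -/
def lastVertex (m : ℕ) [NeZero m] : Fin m := ⟨m - 1, Nat.sub_lt (NeZero.pos m) one_pos⟩

theorem val_add_one {i : Fin m} (hi : i ≠ lastVertex m) : (i + 1).val = i.val + 1 := by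
  have h : i.val ≠ m - 1 := fun h => hi (Fin.ext h)
  have h2 := i.2
  rw [Fin.val_add, Fin.val_one', Nat.add_mod_mod, Nat.mod_eq_of_lt (by omega)]

theorem lastVertex_add_one (m : ℕ) [NeZero m] : lastVertex m + 1 = 0 := by
  have := NeZero.pos m
  ext
  have h : (lastVertex m).val + 1 = m := Nat.sub_add_cancel this
  rw [Fin.val_add, Fin.val_one', Nat.add_mod_mod, h, Nat.mod_self]
  rfl

/-- The partial sums of a family of angles along the cycle. -/
noncomputable def partialAngle (θ : Fin m → ℝ) (i : Fin m) : ℝ :=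
  ∑ l ∈ Finset.range i.val, θ (Fin.ofNat m l)

theorem partialAngle_zero (θ : Fin m → ℝ) : partialAngle θ 0 = 0 := by simp [partialAngle]

theorem partialAngle_add_one (θ : Fin m → ℝ) {i : Fin m} (hi : i ≠ lastVertex m) :
    partialAngle θ (i + 1) = partialAngle θ i + θ i := by
  rw [partialAngle, val_add_one hi, Finset.sum_range_succ]
  simp [partialAngle]

theorem partialAngle_lastVertex_mem {θ : Fin m → ℝ}
    (hθ : ∀ i, i ≠ lastVertex m → θ i ∈ Set.Icc 0 (Real.pi / m)) :
    partialAngle θ (lastVertex m) ∈ Set.Icc 0 Real.pi := by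
  have hm : 0 < m := NeZero.pos m
  have hm0 : (0 : ℝ) < m := by exact_mod_cast hm
  have h : ∀ l ∈ Finset.range (lastVertex m).val,
      θ (Fin.ofNat m l) ∈ Set.Icc 0 (Real.pi / m) := fun l hl => hθ _ fun h => by
    have h1 := congrArg Fin.val h
    have h2 := Finset.mem_range.1 hl
    simp only [lastVertex, Fin.val_ofNat] at h1 h2
    rw [Nat.mod_eq_of_lt (by omega)] at h1
    omega
  refine ⟨Finset.sum_nonneg fun l hl => (h l hl).1, ?_⟩
  refine (Finset.sum_le_sum fun l hl => (h l hl).2).trans ?_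
  simp only [Finset.sum_const, Finset.card_range, nsmul_eq_mul, lastVertex]
  have h3 : ((m - 1 : ℕ) : ℝ) ≤ m := by exact_mod_cast Nat.sub_le m 1
  calc ((m - 1 : ℕ) : ℝ) * (Real.pi / m) ≤ m * (Real.pi / m) := by gcongr
    _ = Real.pi := by field_simp

theorem angle_le_partialAngle {E : Type*} [NormedAddCommGroup E] [InnerProductSpace ℝ E]
    (v : Fin m → E) (hv : v 0 ≠ 0) {θ : Fin m → ℝ}
    (hθ : ∀ i, i ≠ lastVertex m → angle (v i) (v (i + 1)) = θ i) (i : Fin m) :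
    angle (v 0) (v i) ≤ partialAngle θ i := by
  have key : ∀ (n : ℕ) (h : n < m), angle (v 0) (v ⟨n, h⟩) ≤ partialAngle θ ⟨n, h⟩ := by
    intro n
    induction n with
    | zero =>
      intro h
      change angle (v 0) (v 0) ≤ partialAngle θ 0
      rw [angle_self hv, partialAngle_zero]
    | succ n ih =>
      intro h
      have hlast : (⟨n, by omega⟩ : Fin m) ≠ lastVertex m := fun h' => by
        have := congrArg Fin.val h'
        simp only [lastVertex] at this
        omega
      have heq : (⟨n + 1, h⟩ : Fin m) = ⟨n, by omega⟩ + 1 := Fin.ext (val_add_one hlast).symm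
      rw [heq, partialAngle_add_one θ hlast]
      refine (angle_le_angle_add_angle _ (v ⟨n, by omega⟩) _).trans ?_
      rw [hθ _ hlast]
      linarith [ih (by omega)]
  exact key i.1 i.2

/-- On the cone, the last edge is strictly larger than its value at the planar configuration in
which the angles of the other edges add up. -/
theorem lt_of_mem_cone (hm : 3 ≤ m) {s : Fin m ⊕ Fin m → ℝ} (hs : s ∈ cone m) {t θ : Fin m → ℝ}
    (ht : ∀ i, 0 < t i) (hst : ∀ i, s (Sum.inl i) = t i ^ 2)
    (hθ : ∀ i, i ≠ lastVertex m → θ i ∈ Set.Icc 0 (Real.pi / m))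
    (hsθ : ∀ i, i ≠ lastVertex m → s (Sum.inr i) = t i * t (i + 1) * Real.cos (θ i)) :
    t (lastVertex m) * t 0 * Real.cos (partialAngle θ (lastVertex m)) <
      s (Sum.inr (lastVertex m)) := by
  have hm0 : (1 : ℝ) ≤ m := by exact_mod_cast NeZero.pos m
  have hle : ∀ s' ∈ cone m, (∀ i, s' (Sum.inl i) = t i ^ 2) →
      (∀ i, i ≠ lastVertex m → s' (Sum.inr i) = t i * t (i + 1) * Real.cos (θ i)) →
      t (lastVertex m) * t 0 * Real.cos (partialAngle θ (lastVertex m)) ≤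
        s' (Sum.inr (lastVertex m)) := by
    rintro _ ⟨S, hS, rfl⟩ h1 h2
    obtain ⟨v, rfl⟩ := exists_gram_eq hS.posSemidef
    have hnorm : ∀ i, ‖v i‖ = t i := fun i => by
      have := h1 i
      simp only [suffStat, Sum.elim_inl, Matrix.gram_apply, real_inner_self_eq_norm_sq] at this
      exact (sq_eq_sq₀ (norm_nonneg _) (ht i).le).1 this
    have hangle : ∀ i, i ≠ lastVertex m → angle (v i) (v (i + 1)) = θ i := fun i hi => by
      have := h2 i hi
      simp only [suffStat, Sum.elim_inr, Matrix.gram_apply] at this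
      rw [angle, this, hnorm, hnorm, mul_div_cancel_left₀ _ (mul_pos (ht _) (ht _)).ne',
        Real.arccos_cos (hθ i hi).1]
      exact (hθ i hi).2.trans (div_le_self Real.pi_pos.le hm0)
    have hv0 : v 0 ≠ 0 := by rw [← norm_pos_iff, hnorm]; exact ht 0
    have hle := angle_le_partialAngle v hv0 hangle (lastVertex m)
    have hcos := Real.cos_le_cos_of_nonneg_of_le_pi (angle_nonneg _ _)
      (partialAngle_lastVertex_mem hθ).2 hle
    have hinner := cos_angle_mul_norm_mul_norm (v 0) (v (lastVertex m))
    rw [hnorm, hnorm] at hinner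
    simp only [suffStat, Sum.elim_inr, Matrix.gram_apply, lastVertex_add_one]
    rw [real_inner_comm, ← hinner]
    nlinarith [mul_le_mul_of_nonneg_left hcos (mul_pos (ht 0) (ht (lastVertex m))).le]
  -- Strictness comes from openness: the last edge can be lowered slightly inside the cone, and the
  -- weak bound still holds there.
  obtain ⟨ε, hε, hball⟩ := Metric.isOpen_iff.1 (isOpen_cone hm) s hs
  have hmem : s + Pi.single (Sum.inr (lastVertex m)) (-(ε / 2)) ∈ cone m := hball (by
    rw [Metric.mem_ball, dist_eq_norm, add_sub_cancel_left, Pi.norm_single, norm_neg,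
      Real.norm_of_nonneg (by linarith)]
    linarith)
  have := hle _ hmem (fun i => by simp [hst]) fun i hi => by simp [hi, hsθ i hi]
  simp only [Pi.add_apply, Pi.single_eq_same] at this
  linarith

theorem numerator_dvd (hm : 3 ≤ m) {P : MvPolynomial (Fin m) ℂ}
    {Γ f : MvPolynomial (Fin m ⊕ Fin m) ℂ} (hP : IsCyclePolynomial m P) (hΓ : IsNumerator m P Γ)
    (hf : ∀ s ∈ coneBoundary m, eval (toComplex s) f = 0) : Γ ∣ f := by
  have hm0 : (3 : ℝ) ≤ m := by exact_mod_cast hm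
  let c := Real.cos (Real.pi / m)
  have hpm : Real.pi / m ≤ Real.pi / 2 := by gcongr; linarith
  have hpm0 : 0 < Real.pi / m := by positivity
  have hc0 : 0 ≤ c := Real.cos_nonneg_of_mem_Icc ⟨by linarith, hpm⟩
  have hc1 : c < 1 := by
    rw [← Real.cos_zero]
    exact Real.cos_lt_cos_of_nonneg_of_le_pi le_rfl (by linarith) hpm0
  -- Chosen so that `(1 - δ) / (1 + δ) = cos (π / m)`: on the box every normalized edge other than
  -- the last is at least `cos (π / m)`, so each angle is at most `π / m` and their sum stays within
  -- `[0, π]`.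
  let δ := (1 - c) / (1 + c)
  have hδ : 0 < δ := div_pos (by linarith) (by linarith)
  have hδc : 1 - δ = c * (1 + δ) := by
    have : (1 + c) ≠ 0 := by linarith
    simp only [δ]
    field_simp
    ring
  refine dvd_of_common_zeros (Sum.inr (lastVertex m)) (hΓ.irreducible hm hP)
    (Sum.elim (fun _ => Set.Icc 1 (1 + δ)) fun _ => Set.Icc (1 - δ) 1) ?_ fun s hs => ?_
  · rintro (i | i)
    · exact Set.Icc_infinite (by linarith)
    · exact Set.Icc_infinite (by linarith)
  let t : Fin m → ℝ := fun i => Real.sqrt (s (Sum.inl i))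
  have hsl : ∀ i, 1 ≤ s (Sum.inl i) ∧ s (Sum.inl i) ≤ 1 + δ := fun i => hs (Sum.inl i) (by simp)
  have ht : ∀ i, 1 ≤ t i := fun i => Real.one_le_sqrt.2 (hsl i).1
  have ht0 : ∀ i, 0 < t i := fun i => one_pos.trans_le (ht i)
  have ht2 : ∀ i, t i ^ 2 = s (Sum.inl i) := fun i => Real.sq_sqrt (by linarith [(hsl i).1])
  have htt : ∀ i, 1 ≤ t i * t (i + 1) := fun i => one_le_mul_of_one_le_of_one_le (ht _) (ht _)
  have htt' : ∀ i, t i * t (i + 1) ≤ 1 + δ := fun i => by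
    nlinarith [sq_nonneg (t i - t (i + 1)), ht2 i, ht2 (i + 1), (hsl i).2, (hsl (i + 1)).2]
  have hsr : ∀ i, i ≠ lastVertex m → 1 - δ ≤ s (Sum.inr i) ∧ s (Sum.inr i) ≤ 1 :=
    fun i hi => hs (Sum.inr i) (by simpa)
  let θ : Fin m → ℝ := fun i => Real.arccos (s (Sum.inr i) / (t i * t (i + 1)))
  have hxle : ∀ i, i ≠ lastVertex m → s (Sum.inr i) / (t i * t (i + 1)) ≤ 1 := fun i hi =>
    (div_le_one (by linarith [htt i])).2 ((hsr i hi).2.trans (htt i))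
  have hxge : ∀ i, i ≠ lastVertex m → c ≤ s (Sum.inr i) / (t i * t (i + 1)) := fun i hi => by
    rw [le_div_iff₀ (by linarith [htt i])]
    exact (mul_le_mul_of_nonneg_left (htt' i) hc0).trans (hδc ▸ (hsr i hi).1)
  have hθ : ∀ i, i ≠ lastVertex m → θ i ∈ Set.Icc 0 (Real.pi / m) := fun i hi => by
    refine ⟨Real.arccos_nonneg _, ?_⟩
    rw [← Real.arccos_cos hpm0.le (by linarith [Real.pi_pos])]
    exact Real.antitone_arccos (hxge i hi)
  have hcosθ : ∀ i, i ≠ lastVertex m → s (Sum.inr i) = t i * t (i + 1) * Real.cos (θ i) :=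
    fun i hi => by
      rw [Real.cos_arccos (by linarith [hxge i hi]) (hxle i hi), mul_div_assoc',
        mul_div_cancel_left₀ _ (by linarith [htt i])]
  let φ := partialAngle θ
  -- The planar fan with lengths `t i` and polar angles `φ i`; `y` is the inner product of its two
  -- extreme vectors.
  let z : Fin m → ℂ := fun i => ⟨t i * Real.cos (φ i), t i * Real.sin (φ i)⟩
  let y := t (lastVertex m) * t 0 * Real.cos (φ (lastVertex m))
  let s' := Function.update s (Sum.inr (lastVertex m)) y
  have hs'l : ∀ i, s' (Sum.inl i) = t i ^ 2 := fun i => by simp [s', ht2]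
  have hs'k : s' (Sum.inr (lastVertex m)) = y := by simp [s']
  have hs'r : ∀ i, i ≠ lastVertex m → s' (Sum.inr i) = t i * t (i + 1) * Real.cos (θ i) :=
    fun i hi => by simp [s', hi, ← hcosθ i hi]
  have hz2 : ∀ i j, (z i).re * (z j).re + (z i).im * (z j).im =
      t i * t j * Real.cos (φ j - φ i) := fun i j => by
    rw [Real.cos_sub]
    simp only [z]
    ring
  have hnorm : ∀ i, s' (Sum.inl i) = ‖z i‖ ^ 2 := fun i => by
    rw [hs'l, Complex.sq_norm, Complex.normSq_apply, hz2, sub_self, Real.cos_zero]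
    ring
  have hedge : ∀ i, s' (Sum.inr i) = (z i).re * (z (i + 1)).re + (z i).im * (z (i + 1)).im :=
    fun i => by
      rw [hz2]
      by_cases hi : i = lastVertex m
      · rw [hi, hs'k, lastVertex_add_one]
        simp only [φ, partialAngle_zero, zero_sub, Real.cos_neg, y]
      · rw [hs'r i hi]
        simp only [φ, partialAngle_add_one θ hi, add_sub_cancel_left]
  have hz0 : ∀ i, z i ≠ 0 := fun i h => by
    have := hnorm i
    rw [h, hs'l, norm_zero] at this
    exact (pow_pos (ht0 i) 2).ne' (by simpa using this)
  have hbd : s' ∈ coneBoundary m := by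
    refine ⟨?_, fun h => ?_⟩
    · have : suffStat m (Matrix.gram ℝ z) = s' := by
        funext i
        rcases i with i | i
        · simp only [suffStat, Sum.elim_inl, Matrix.gram_apply, real_inner_self_eq_norm_sq, hnorm]
        · simp only [suffStat, Sum.elim_inr, Matrix.gram_apply, Complex.inner, hedge]
          simp only [Complex.mul_re, Complex.conj_re, Complex.conj_im]
          ring
      rw [← this]
      exact suffStat_mem_closure_cone (Matrix.posSemidef_gram ℝ z)
    · have := lt_of_mem_cone hm h ht0 hs'l hθ hs'r
      rw [hs'k] at this
      exact lt_irrefl _ this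
  refine ⟨y, ?_, hf _ hbd⟩
  obtain ⟨D, -, -, hD⟩ := hΓ
  change eval (toComplex s') Γ = 0
  rw [hD s' fun i => by rw [hs'l]; exact pow_pos (ht0 i) 2,
    eval_normalize_of_planar (isCyclePolynomial_iff.1 hP).2 hz0 hnorm hedge, mul_zero]

theorem realVanishingIdeal_coneBoundary (hm : 4 ≤ m) {P : MvPolynomial (Fin m) ℂ}
    {Γ : MvPolynomial (Fin m ⊕ Fin m) ℂ} (hP : IsCyclePolynomial m P) (hΓ : IsNumerator m P Γ) :
    realVanishingIdeal (coneBoundary m) = Ideal.span {boundaryPolynomial m Γ} := by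
  ext f
  have hmem : f ∈ realVanishingIdeal (coneBoundary m) ↔
      ∀ s ∈ coneBoundary m, eval (toComplex s) f = 0 := by
    simp [realVanishingIdeal, mem_vanishingIdeal_iff, aeval_eq_eval]
  rw [hmem, Ideal.mem_span_singleton]
  refine ⟨fun h => boundaryPolynomial_dvd (by omega) hP hΓ (numerator_dvd (by omega) hP hΓ h)
    (edgeMinor_dvd hm h), ?_⟩
  rintro ⟨R, rfl⟩ s hs
  rw [map_mul, eval_boundaryPolynomial_of_mem_coneBoundary (by omega) hP hΓ hs, zero_mul]

end Density

end CycleCone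

/-- For `m ≥ 4`: the cycle polynomial exists and is unique up to scaling, its numerator `Γ` under
the substitution exists and is unique up to scaling, and the Zariski closure of the boundary of the
cone is the hypersurface with defining polynomial `H = Γ · ∏ᵢ (s_{i,i} s_{i+1,i+1} - s_{i,i+1}²)`,
that is, the closure is the zero set of `H`, and `H` generates its vanishing ideal. -/
theorem theorem4p7 (m : ℕ) [NeZero m] (hm : 4 ≤ m) :
    (∃ P : MvPolynomial (Fin m) ℂ, CycleCone.IsCyclePolynomial m P) ∧
    (∀ P P' : MvPolynomial (Fin m) ℂ,
      CycleCone.IsCyclePolynomial m P → CycleCone.IsCyclePolynomial m P' →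
        ∃ c : ℂ, c ≠ 0 ∧ P' = MvPolynomial.C c * P) ∧
    ∀ P : MvPolynomial (Fin m) ℂ, CycleCone.IsCyclePolynomial m P →
      (∃ Γ : MvPolynomial (Fin m ⊕ Fin m) ℂ, CycleCone.IsNumerator m P Γ) ∧
      (∀ Γ Γ' : MvPolynomial (Fin m ⊕ Fin m) ℂ,
        CycleCone.IsNumerator m P Γ → CycleCone.IsNumerator m P Γ' →
          ∃ c : ℂ, c ≠ 0 ∧ Γ' = MvPolynomial.C c * Γ) ∧
      ∀ Γ : MvPolynomial (Fin m ⊕ Fin m) ℂ, CycleCone.IsNumerator m P Γ →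
        CycleCone.zariskiClosure (CycleCone.coneBoundary m) =
            {s : Fin m ⊕ Fin m → ℂ |
              MvPolynomial.eval s (CycleCone.boundaryPolynomial m Γ) = 0} ∧
          CycleCone.realVanishingIdeal (CycleCone.coneBoundary m) =
            Ideal.span {CycleCone.boundaryPolynomial m Γ} := by
  refine ⟨CycleCone.exists_isCyclePolynomial m, fun P P' h h' => h.unique h', fun P hP =>
    ⟨hP.exists_isNumerator (by omega), fun Γ Γ' h h' => h.unique h', fun Γ hΓ => ?_⟩⟩
  have h := CycleCone.realVanishingIdeal_coneBoundary hm hP hΓ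
  refine ⟨?_, h⟩
  ext s
  simp [CycleCone.zariskiClosure, h, MvPolynomial.zeroLocus_span, MvPolynomial.aeval_eq_eval]
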